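/- A box is a pair (row, column), rows being numbered from top to bottom and columns from left to right. For a strict partition $\lambda=(\lambda_1>\dots>\lambda_k>0)$ the \emph{shifted shape} $\lambda$ has $\lambda_i$ boxes in row $i$, in the columns $i,\dots,i+\lambda_i-1$. An \emph{increasing shifted tableau} of shape $\lambda$ (resp. skew shape $\lambda/\mu$ with $\mu\subseteq\lambda$) is a filling of the boxes of $\lambda$ (resp. $\lambda\setminus\mu$) with positive integers, strictly increasing left to right along rows and top to bottom down columns. \emph{Shifted Hecke insertion.} To insert a positive integer $x$ into an increasing shifted tableau $T$, start by inserting $x$ into the first row. To insert $x$ into a row (resp. column): (1) if $x$ is weakly larger than all entries of the row (resp. column) and adjoining $x$ at its end gives an increasing shifted tableau, do so and stop (the end of an empty row is its position on the main diagonal, the end of an empty column its position in the first row); (2) if $x$ is weakly larger than all entries but adjoining $x$ does not give an increasing shifted tableau, stop without change. Otherwise let $y$ be the smallest entry of the row (resp. column) that is strictly larger than $x$: (3) if replacing $y$ by $x$ gives an increasing shifted tableau, replace it; (4) otherwise change nothing; in both cases continue by inserting $y$ into the next column to the right if $x$ was inserted into a column or if $y$ was on the main diagonal, and into the next row below otherwise.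 The insertion tableau $P(w)$ of a word $w=w_1\cdots w_n$ of positive integers is obtained by inserting $w_1,\dots,w_n$ successively, starting from the empty tableau. \emph{Shifted $K$-rectification.} For labels $r$ and $\circ$, the switch $(r,\circ)$ simultaneously relabels by $\circ$ each box labelled $r$ that shares an edge with a box labelled $\circ$, and by $r$ each box labelled $\circ$ that shares an edge with a box labelled $r$. Let $T$ be an increasing shifted tableau of skew shape $\lambda/\mu$ with largest entry $q$. Number the boxes of $\mu$ by $1,\dots,p=|\mu|$, row by row from top to bottom and left to right in each row. The \emph{superstandard $K$-rectification} of $T$ is obtained by performing the following slide for $k=p,p-1,\dots,1$: label box number $k$ of $\mu$ by $\circ$, perform the switches $(1,\circ),(2,\circ),\dots,(q,\circ)$ in this order, and delete the boxes labelled $\circ$. \emph{The antidiagonal tableau.} For a word $w=w_1\cdots w_n$ of positive integers, $T_w$ is the increasing shifted tableau of skew shape $(2n-1,2n-3,\dots,1)/(2n-2,2n-4,\dots,2)$ whose entry in row $n+1-i$ and column $n-1+i$ is $w_i$, for $1\le i\le n$; so $w_1$ is in the bottom box, on the main diagonal. \textbf{Theorem.} For every word $w$ of positive integers, the superstandard $K$-rectification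 of $T_w$ equals the insertion tableau $P(w)$. -/

import Mathlib

namespace ShiftedHecke

/-! ### Shifted shapes and increasing shifted tableaux

A box is a pair `(row, column)`, counted from `0`, rows from top to bottom and columns from left to
right.  The main diagonal consists of the boxes `(i, i)`. -/

/-- A box `(row, column)`. -/
abbrev Box : Type := ℕ × ℕ

/-- A filling of some boxes by labels in `α`; the value `none` means that the box is absent. -/
abbrev Filling (α : Type) : Type := Box → Option α

/-- The filling `T` with box `b` (re)labelled by `x`; if `b` was absent, it is added. -/
def Filling.set {α : Type} (T : Filling α) (b : Box) (x : α) : Filling α :=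
  Function.update T b (some x)

/-- The list `l` is a strict partition `l₁ > l₂ > ⋯ > l_k > 0`. -/
def IsStrictPartition (l : List ℕ) : Prop :=
  l.Pairwise (fun a b => b < a) ∧ ∀ a ∈ l, 0 < a

/-- The shifted shape of `l`: row `i` consists of `lᵢ` boxes, the first of them on the diagonal. -/
def shiftedShape (l : List ℕ) : Set Box :=
  {b | b.1 ≤ b.2 ∧ b.2 < b.1 + l.getD b.1 0}

/-- The labels strictly increase from left to right along rows and from top to bottom down
columns. -/
def IsIncreasing (T : Filling ℕ) : Prop :=
  (∀ i j j' x y, j < j' → T (i, j) = some x → T (i, j') = some y → x < y) ∧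
  (∀ i i' j x y, i < i' → T (i, j) = some x → T (i', j) = some y → x < y)

/-- An increasing shifted skew tableau of shape `outer / inner`, filled by positive integers. -/
structure SkewTableau where
  outer : List ℕ
  inner : List ℕ
  outer_strict : IsStrictPartition outer
  inner_strict : IsStrictPartition inner
  inner_subset : shiftedShape inner ⊆ shiftedShape outer
  entry : Filling ℕ
  isSome_iff : ∀ b, (entry b).isSome ↔ b ∈ shiftedShape outer \ shiftedShape inner
  pos : ∀ b x, entry b = some x → 0 < x
  increasing : IsIncreasing entry

/-- `T` is an increasing shifted tableau (of some shifted straight shape). -/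
def IsIncreasingTableau (T : Filling ℕ) : Prop :=
  ∃ l : List ℕ, IsStrictPartition l ∧ (∀ b, (T b).isSome ↔ b ∈ shiftedShape l) ∧
    (∀ b x, T b = some x → 0 < x) ∧ IsIncreasing T

/-! ### Shifted Hecke insertion -/

/-- A row or a column, into which a letter is inserted. -/
inductive Line : Type
  | row (i : ℕ)
  | col (j : ℕ)

/-- The box `b` lies on the line. -/
def Line.Contains : Line → Box → Prop
  | .row i, b => b.1 = i
  | .col j, b => b.2 = j

/-- `b` is the position at which a new box is adjoined to the end of the line: the first absent
position of the row, starting from the main diagonal, respectively the first absent position of the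
column, starting from the top row. -/
def Line.IsEnd (T : Filling ℕ) : Line → Box → Prop
  | .row i, b => b.1 = i ∧ i ≤ b.2 ∧ T b = none ∧ ∀ j, i ≤ j → j < b.2 → T (i, j) ≠ none
  | .col j, b => b.2 = j ∧ T b = none ∧ ∀ i, i < b.1 → T (i, j) ≠ none

/-- The line into which the output integer is inserted, when the output integer was found in the
box `b` of the given line: the next column to the right after a column insertion or if `b` is on the
main diagonal, the row below otherwise. -/
def Line.next : Line → Box → Line
  | .row i, b => if b.1 = b.2 then .col (b.2 + 1) else .row (i + 1)
  | .col j, _ => .col (j + 1)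

/-- `x` is weakly larger than all integers in the line. -/
def Line.AllLE (T : Filling ℕ) (L : Line) (x : ℕ) : Prop :=
  ∀ b y, L.Contains b → T b = some y → y ≤ x

/-- The box `b` of the line has label `y`, and `y` is the smallest label of the line that is
strictly larger than `x`. -/
def Line.IsBumped (T : Filling ℕ) (L : Line) (x : ℕ) (b : Box) (y : ℕ) : Prop :=
  L.Contains b ∧ T b = some y ∧ x < y ∧
    ∀ c z, L.Contains c → T c = some z → x < z → y ≤ z

/-- `InsertsTo L T x T'`: inserting `x` into the line `L` of `T`, and carrying on with the output
integers until the insertion terminates, results in `T'`. The constructors are the four rules of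
shifted Hecke insertion. -/
inductive InsertsTo : Line → Filling ℕ → ℕ → Filling ℕ → Prop
  | adjoin {L : Line} {T : Filling ℕ} {x : ℕ} {b : Box}
      (hx : L.AllLE T x) (hb : L.IsEnd T b) (h : IsIncreasingTableau (T.set b x)) :
      InsertsTo L T x (T.set b x)
  | stay {L : Line} {T : Filling ℕ} {x : ℕ} {b : Box}
      (hx : L.AllLE T x) (hb : L.IsEnd T b) (h : ¬ IsIncreasingTableau (T.set b x)) :
      InsertsTo L T x T
  | replace {L : Line} {T T' : Filling ℕ} {x y : ℕ} {b : Box}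
      (hb : L.IsBumped T x b y) (h : IsIncreasingTableau (T.set b x))
      (rest : InsertsTo (L.next b) (T.set b x) y T') :
      InsertsTo L T x T'
  | bump {L : Line} {T T' : Filling ℕ} {x y : ℕ} {b : Box}
      (hb : L.IsBumped T x b y) (h : ¬ IsIncreasingTableau (T.set b x))
      (rest : InsertsTo (L.next b) T y T') :
      InsertsTo L T x T'

/-- `IsInsertionTableau w P`: shifted Hecke insertion of the letters of `w` from left to right,
each starting in the first row, and beginning with the empty tableau, results in `P`. -/
inductive IsInsertionTableau : List ℕ → Filling ℕ → Prop
  | nil : IsInsertionTableau [] (fun _ => none)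
  | snoc {w : List ℕ} {x : ℕ} {T T' : Filling ℕ}
      (hT : IsInsertionTableau w T) (hx : InsertsTo (.row 0) T x T') :
      IsInsertionTableau (w ++ [x]) T'

/-! ### Shifted K-theoretic jeu de taquin -/

/-- Two boxes are adjacent if they share a common edge. -/
def Adjacent (a b : Box) : Prop :=
  (a.1 = b.1 ∧ (a.2 + 1 = b.2 ∨ b.2 + 1 = a.2)) ∨
  (a.2 = b.2 ∧ (a.1 + 1 = b.1 ∨ b.1 + 1 = a.1))

open Classical in
/-- The K-theoretic switch operator `(i, j)`. -/
noncomputable def switch {α : Type} (i j : α) (T : Filling α) : Filling α := fun a =>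
  if T a = some i ∧ ∃ b, Adjacent a b ∧ T b = some j then some j
  else if T a = some j ∧ ∃ b, Adjacent a b ∧ T b = some i then some i
  else T a

/-- Labels during a slide: the symbol `∘` or a number. -/
inductive Label : Type
  | circ
  | num (n : ℕ)

open Classical in
/-- The filling `T` with the boxes of `C` labelled by `∘`. -/
noncomputable def addCirc (C : Set Box) (T : Filling ℕ) : Filling Label := fun b =>
  if b ∈ C then some .circ else (T b).map .num

/-- Delete the boxes that are labelled by `∘`. -/
def eraseCirc (T : Filling Label) : Filling ℕ := fun b =>
  match T b with
  | some (.num n) => some n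
  | _ => none

/-- The forward slide of `T`, with values in the interval `[lo, hi]`, starting from `C`: the
switches `(lo, ∘), (lo + 1, ∘), …, (hi, ∘)` are performed in this order. -/
noncomputable def kjdt (lo hi : ℕ) (C : Set Box) (T : Filling ℕ) : Filling ℕ :=
  eraseCirc ((List.range' lo (hi + 1 - lo)).foldl (fun S r => switch (.num r) .circ S)
    (addCirc C T))

/-- The superstandard tableau of shifted shape `l`: the rows are filled from top to bottom, each
from left to right, by `1, 2, …, |l|`. -/
def superstandard (l : List ℕ) : Filling ℕ := fun b =>
  if b.1 ≤ b.2 ∧ b.2 < b.1 + l.getD b.1 0 then some ((l.take b.1).sum + (b.2 - b.1) + 1) else none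

/-- The largest entry of `T` (`0` if there are no entries). -/
noncomputable def SkewTableau.maxEntry (T : SkewTableau) : ℕ :=
  sSup {x | ∃ b, T.entry b = some x}

/-- The superstandard K-rectification of a shifted skew tableau of shape `λ/μ`. The box of `μ` with
label `k` in the superstandard tableau of shape `μ` is the starting box of a forward slide; these
slides are performed for `k = |μ|, |μ| - 1, …, 1`, in this order. -/
noncomputable def SkewTableau.superstandardRectification (T : SkewTableau) : Filling ℕ :=
  (List.range' 1 T.inner.sum).reverse.foldl
    (fun S k => kjdt 1 T.maxEntry {b | superstandard T.inner b = some k} S) T.entry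

/-! ### The antidiagonal tableau of a word -/

/-- The filling of the antidiagonal by `w = w₁ ⋯ wₙ`: the box in row `i` (counted from `0`) and
column `2 (n - 1) - i` is labelled by `w_{n-i}`, so that the bottom box, labelled by `w₁`, is on the
main diagonal, and the labels from bottom to top are `w₁, …, wₙ`. -/
def antidiagonalFilling (w : List ℕ) : Filling ℕ := fun b =>
  if b.1 + b.2 + 2 = 2 * w.length then w.reverse[b.1]? else none

/-- The outer shape `(2n - 1, 2n - 3, …, 1)`. -/
def antidiagonalOuter (n : ℕ) : List ℕ := (List.range n).map fun i => 2 * (n - i) - 1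

/-- The inner shape `(2n - 2, 2n - 4, …, 2)`. -/
def antidiagonalInner (n : ℕ) : List ℕ := (List.range (n - 1)).map fun i => 2 * (n - i) - 2

theorem antidiagonalOuter_getD (n i : ℕ) :
    (antidiagonalOuter n).getD i 0 = 2 * (n - i) - 1 := by
  unfold antidiagonalOuter
  by_cases h : i < n
  · simp [List.getD, h]
  · simp [List.getD, h]; omega

theorem antidiagonalInner_getD (n i : ℕ) :
    (antidiagonalInner n).getD i 0 = 2 * (n - i) - 2 := by
  unfold antidiagonalInner
  by_cases h : i < n - 1
  · simp [List.getD, h]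
  · simp [List.getD, h]; omega

theorem antidiagonalFilling_row {w : List ℕ} {b : Box} {x : ℕ}
    (h : antidiagonalFilling w b = some x) : b.1 + b.2 + 2 = 2 * w.length ∧ b.1 < w.length := by
  unfold antidiagonalFilling at h
  split_ifs at h with h1
  obtain ⟨h2, -⟩ := List.getElem?_eq_some_iff.1 h
  exact ⟨h1, by simpa using h2⟩

theorem isSome_getElem?_iff (l : List ℕ) (i : ℕ) : (l[i]?).isSome ↔ i < l.length := by
  simp

/-- The antidiagonal tableau `T_w` of a word `w` of positive integers. -/
def antidiagonalTableau (w : List ℕ) (hw : ∀ x ∈ w, 0 < x) : SkewTableau where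
  outer := antidiagonalOuter w.length
  inner := antidiagonalInner w.length
  outer_strict := by
    refine ⟨?_, ?_⟩
    · unfold antidiagonalOuter
      rw [List.pairwise_map]
      refine List.Pairwise.imp_of_mem ?_ (List.pairwise_lt_range (n := w.length))
      intro a b ha hb hab
      rw [List.mem_range] at ha hb
      omega
    · intro a ha
      unfold antidiagonalOuter at ha
      simp only [List.mem_map, List.mem_range] at ha
      obtain ⟨i, hi, rfl⟩ := ha
      omega
  inner_strict := by
    refine ⟨?_, ?_⟩
    · unfold antidiagonalInner
      rw [List.pairwise_map]
      refine List.Pairwise.imp_of_mem ?_ (List.pairwise_lt_range (n := w.length - 1))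
      intro a b ha hb hab
      rw [List.mem_range] at ha hb
      omega
    · intro a ha
      unfold antidiagonalInner at ha
      simp only [List.mem_map, List.mem_range] at ha
      obtain ⟨i, hi, rfl⟩ := ha
      omega
  inner_subset := by
    rintro b ⟨h1, h2⟩
    rw [antidiagonalInner_getD] at h2
    refine ⟨h1, ?_⟩
    rw [antidiagonalOuter_getD]
    omega
  entry := antidiagonalFilling w
  isSome_iff := by
    intro b
    simp only [shiftedShape, Set.mem_sdiff, Set.mem_ofPred_eq, antidiagonalInner_getD,
      antidiagonalOuter_getD, antidiagonalFilling]
    split_ifs with h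
    · rw [isSome_getElem?_iff, List.length_reverse]
      omega
    · simp only [Option.isSome_none]
      constructor
      · intro h'
        cases h'
      · intro h'
        omega
  pos := by
    intro b x h
    unfold antidiagonalFilling at h
    split_ifs at h
    exact hw x (List.mem_reverse.1 (List.mem_of_getElem? h))
  increasing := by
    constructor
    · intro i j j' x y hj hx hy
      have h1 := (antidiagonalFilling_row hx).1
      have h2 := (antidiagonalFilling_row hy).1
      simp only at h1 h2
      omega
    · intro i i' j x y hi hx hy
      have h1 := (antidiagonalFilling_row hx).1
      have h2 := (antidiagonalFilling_row hy).1
      simp only at h1 h2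
      omega

end ShiftedHecke

/-!
The last letter of `w x` is slid last.  Up to a shift by one row and one column, `T_{wx}` is `T_w`
with an additional box labelled `x` in the first row, so by induction the first slides turn it into
`P(w)`, shifted, together with this box; it remains to see that the slides from the boxes
`N, …, 2, 1` of the first row insert `x` into `P(w)`.

Instead of sliding these boxes one after the other past all labels, one can move all of them, as an
increasing tableau `1, 2, …, N`, past the boxes labelled `1`, then past those labelled `2`, and so
on: the result is the same, as both are encoded by one growth diagram.  In this order the diagram
can be written down.  Before the label `x` the numbers `1, …, N` stay in the first row.  From then
on, the boxes of `P(w)` with labels at most `t` grow exactly as they do in the insertion, and the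
numbers are pushed along the border of this shape, in a position that is determined by the row or
column, and the letter, with which the insertion goes on.
-/

namespace ShiftedHecke

/-- The value to the left of column `j` in the row `r`, and `0` to the left of column `0`. -/
def leftOf (r : ℕ → ℕ) : ℕ → ℕ
  | 0 => 0
  | j + 1 => r j

/-- The row above row `i` of `U`, and the zero row above row `0`. -/
def rowAbove (U : ℕ → ℕ → ℕ) : ℕ → ℕ → ℕ
  | 0 => fun _ => 0
  | i + 1 => U i

/-- The local rules of a step of a growth diagram with values in `[0, M]`, for one of its rows: the
old row `r` turns into the new row `r'`, `x` is the old row above, and `y` the new row below. -/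
structure RowStep (M : ℕ) (x r r' y : ℕ → ℕ) : Prop where
  le (j : ℕ) : r' j ≤ r j
  eq_max (j : ℕ) (h : r' j < r j) : r' j = max (leftOf r j) (x j)
  lt_iff (j : ℕ) (h0 : 0 < r j) (hM : r j < M) : r' j < r j ↔ r' (j + 1) = r j ∨ y j = r j

/-- One step of a growth diagram with values in `[0, M]`. -/
def SlideStep (M : ℕ) (U V : ℕ → ℕ → ℕ) : Prop :=
  ∀ i, RowStep M (rowAbove U i) (U i) (V i) (V (i + 1))

theorem SlideStep.of_rowStep {M : ℕ} {U V : ℕ → ℕ → ℕ}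
    (h0 : RowStep M (fun _ => 0) (U 0) (V 0) (V (0 + 1)))
    (h : ∀ i, RowStep M (U i) (U (i + 1)) (V (i + 1)) (V (i + 1 + 1))) : SlideStep M U V
  | 0 => h0
  | i + 1 => h i

/-- The general row of our growth diagrams: it is `0` before column `K`, maximal from column `S` on,
and in between it is `o` in column `K` and `j + c` in the columns `j` after `K`. -/
def growthRow (M K S o c j : ℕ) : ℕ :=
  if j < K then 0 else if S ≤ j then M else if j = K then o else j + c

section

variable {M K K' S S' o o' c c' Ky Sy oy cy : ℕ} {x y : ℕ → ℕ}

theorem growthRow_cases (M K S o c j : ℕ) :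
    (j < K ∧ growthRow M K S o c j = 0) ∨ (K ≤ j ∧ S ≤ j ∧ growthRow M K S o c j = M) ∨
    (j = K ∧ j < S ∧ growthRow M K S o c j = o) ∨
    (K < j ∧ j < S ∧ growthRow M K S o c j = j + c) := by
  unfold growthRow
  split_ifs <;> omega

theorem leftOf_growthRow_cases (M K S o c j : ℕ) :
    (j ≤ K ∧ leftOf (growthRow M K S o c) j = 0) ∨
    (K < j ∧ S < j ∧ leftOf (growthRow M K S o c) j = M) ∨
    (j = K + 1 ∧ j ≤ S ∧ leftOf (growthRow M K S o c) j = o) ∨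
    (K + 1 < j ∧ j ≤ S ∧ leftOf (growthRow M K S o c) j + 1 = j + c) := by
  rcases j with _ | j
  · simp [leftOf]
  · have := growthRow_cases M K S o c j
    simp only [leftOf]
    omega

theorem RowStep.blank (hK : K = S) (hK' : K' = S)
    (hS : S' = S ∨ S' = S + 1 ∧ o' ≤ M ∧ x S = o') :
    RowStep M x (growthRow M K S o c) (growthRow M K' S' o' c') y := by
  subst hK hK'
  refine ⟨fun j => ?_, fun j hj => ?_, fun j _ _ => ?_⟩
  all_goals
    have := growthRow_cases M K' K' o c j
    have := growthRow_cases M K' S' o' c' j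
  · omega
  · have := leftOf_growthRow_cases M K' K' o c j
    obtain rfl : j = K' := by omega
    omega
  · omega

theorem RowStep.stay (hK : K' = K) (hc : c' = c) (hKS : K < S) (hM : S + c ≤ M) (ho : o ≤ K + c)
    (hS : S' = S ∨ S' = S + 1 ∧ x S = S + c) (hKy : Ky ≤ K + 1) (hSy : Sy ≤ K + 1)
    (ho' : o' = o ∧ growthRow M Ky Sy oy cy K ≠ o ∨
      o' < o ∧ o' = x K ∧ growthRow M Ky Sy oy cy K = o) :
    RowStep M x (growthRow M K S o c) (growthRow M K' S' o' c') (growthRow M Ky Sy oy cy) := by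
  subst hK hc
  refine ⟨fun j => ?_, fun j hj => ?_, fun j h0 hj => ?_⟩
  all_goals
    have := growthRow_cases M K' S o c' j
    have := growthRow_cases M K' S' o' c' j
  · omega
  · have := leftOf_growthRow_cases M K' S o c' j
    obtain rfl | rfl : j = S ∨ j = K' := by omega
    all_goals omega
  · have := growthRow_cases M K' S' o' c' (j + 1)
    obtain rfl | hj : j = K' ∨ K' < j := by omega
    · omega
    · have := growthRow_cases M Ky Sy oy cy j
      omega

theorem RowStep.advance (hK : K' = K + 1) (ho' : o' = o) (hc : c' = c) (hKS : K + 1 < S)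
    (hM : S + c ≤ M) (ho : o ≤ K + c) (hS : S' = S ∨ S' = S + 1 ∧ x S = S + c)
    (hx : x K = 0) (hx' : x (K + 1) ≤ o) (hKy : Ky ≤ K + 2) (hSy : Sy ≤ K + 2)
    (hy : growthRow M Ky Sy oy cy (K + 1) = K + 1 + c) :
    RowStep M x (growthRow M K S o c) (growthRow M K' S' o' c') (growthRow M Ky Sy oy cy) := by
  subst hK ho' hc
  refine ⟨fun j => ?_, fun j hj => ?_, fun j h0 hj => ?_⟩
  all_goals
    have := growthRow_cases M K S o' c' j
    have := growthRow_cases M (K + 1) S' o' c' j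
  · omega
  · have := leftOf_growthRow_cases M K S o' c' j
    obtain rfl | rfl | rfl : j = S ∨ j = K ∨ j = K + 1 := by omega
    all_goals omega
  · have := growthRow_cases M (K + 1) S' o' c' (j + 1)
    obtain rfl | rfl | hj : j = K ∨ j = K + 1 ∨ K + 1 < j := by omega
    · omega
    · omega
    · have := growthRow_cases M Ky Sy oy cy j
      omega

theorem RowStep.grow (hK : K' = K + 1) (ho' : o' = K + 1 + c) (hc : c' = c) (hKS : K + 1 < S)
    (hM : S + c ≤ M) (ho : o ≤ K + c) (hS : S' = S ∨ S' = S + 1 ∧ x S = S + c) (hx : x K = 0)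
    (hKy : Ky ≤ K + 1) (hSy : Sy ≤ K + 1) (hy : growthRow M Ky Sy oy cy K = o) :
    RowStep M x (growthRow M K S o c) (growthRow M K' S' o' c') (growthRow M Ky Sy oy cy) := by
  subst hK ho' hc
  refine ⟨fun j => ?_, fun j hj => ?_, fun j h0 hj => ?_⟩
  all_goals
    have := growthRow_cases M K S o c' j
    have := growthRow_cases M (K + 1) S' (K + 1 + c') c' j
  · omega
  · have := leftOf_growthRow_cases M K S o c' j
    obtain rfl | rfl : j = S ∨ j = K := by omega
    all_goals omega
  · have := growthRow_cases M (K + 1) S' (K + 1 + c') c' (j + 1)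
    obtain rfl | hj : j = K ∨ K < j := by omega
    · omega
    · have := growthRow_cases M Ky Sy oy cy j
      omega

theorem RowStep.activate_stay (hK : K' = K) (hc : c = 1) (hc' : c' = 0) (hS : S = K + 1)
    (hS' : S' = K + 2) (hM : K + 1 < M) (ho : o ≤ K + 1) (hx : x (K + 1) = K + 1)
    (ho' : o' = o ∧ y K ≠ o ∧ o ≠ K + 1 ∨ o' < o ∧ o' = x K ∧ o = K + 1) :
    RowStep M x (growthRow M K S o c) (growthRow M K' S' o' c') y := by
  subst hK hc hc' hS hS'
  refine ⟨fun j => ?_, fun j hj => ?_, fun j h0 hj => ?_⟩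
  all_goals
    have := growthRow_cases M K' (K' + 1) o 1 j
    have := growthRow_cases M K' (K' + 2) o' 0 j
  · omega
  · have := leftOf_growthRow_cases M K' (K' + 1) o 1 j
    obtain rfl | rfl : j = K' ∨ j = K' + 1 := by omega
    all_goals omega
  · have := growthRow_cases M K' (K' + 2) o' 0 (j + 1)
    obtain rfl : j = K' := by omega
    omega

theorem RowStep.activate_advance (hK : K' = K + 1) (hc : c = 1) (hc' : c' = 0) (ho' : o' = o)
    (hS' : S' = S + 1) (hKS : K < S) (hM : S < M) (ho : o ≤ K + 1) (hx : x K = 0)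
    (hx' : x (K + 1) ≤ o) (hxS : ∀ j, K + 1 < j → j ≤ S → x j ≤ j) :
    RowStep M x (growthRow M K S o c) (growthRow M K' S' o' c') y := by
  subst hK hc hc' ho' hS'
  refine ⟨fun j => ?_, fun j hj => ?_, fun j h0 hj => ?_⟩
  all_goals
    have := growthRow_cases M K S o' 1 j
    have := growthRow_cases M (K + 1) (S + 1) o' 0 j
  · omega
  · have := leftOf_growthRow_cases M K S o' 1 j
    obtain rfl | rfl | ⟨hj, hjS⟩ : j = K ∨ j = K + 1 ∨ K + 1 < j ∧ j ≤ S := by omega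
    · omega
    · omega
    · have := hxS j hj hjS
      omega
  · have := growthRow_cases M (K + 1) (S + 1) o' 0 (j + 1)
    omega

end

/-- Row ends of the shape obtained from the shape with row ends `a` by moving it one row down and
one column to the right, and placing a row with end `N` on top. -/
def skewEnd (N : ℕ) (a : ℕ → ℕ) : ℕ → ℕ
  | 0 => N
  | i + 1 => a i + 1

theorem skewEnd_zero (N : ℕ) (a : ℕ → ℕ) : skewEnd N a 0 = N :=
  rfl

theorem skewEnd_succ (N : ℕ) (a : ℕ → ℕ) (i : ℕ) : skewEnd N a (i + 1) = a i + 1 :=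
  rfl

/-- The columns `i ≤ j < a i` of the rows `i` form a shifted shape. -/
structure IsShape (a : ℕ → ℕ) : Prop where
  le (i : ℕ) : i ≤ a i
  succ (i : ℕ) : a (i + 1) ≤ a i ∨ a (i + 1) ≤ i + 1

/-- The shape with row ends `b` arises from the one with row ends `a` by adding boxes, no two of
them in the same row or column. -/
structure RookStrip (a b : ℕ → ℕ) : Prop where
  le (i : ℕ) : a i ≤ b i
  le_succ (i : ℕ) : b i ≤ a i + 1
  succ (i : ℕ) : b (i + 1) ≤ a (i + 1) ∨ b (i + 1) ≤ a i

theorem RookStrip.dichotomy {a b : ℕ → ℕ} (ha : IsShape a) (hb : IsShape b) (h : RookStrip a b)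
    (i : ℕ) : (a i = i ∧ a (i + 1) = i + 1 ∧ b (i + 1) = i + 1) ∨ (i < a i ∧ b (i + 1) ≤ a i) := by
  have := ha.le i
  have := hb.le (i + 1)
  have := ha.le (i + 1)
  have := ha.succ i
  have := h.succ i
  have := h.le (i + 1)
  omega

theorem RookStrip.lt_skewEnd {a b : ℕ → ℕ} (ha : IsShape a) (hb : IsShape b)
    (h : RookStrip a b) {N : ℕ} (hN : b 0 < N) (i : ℕ) :
    b i < skewEnd N a i ∨ (a i = i ∧ b i = i ∧ skewEnd N a i = i) := by
  have := h.le 0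
  have := ha.le 0
  rcases i with _ | i
  · simp only [skewEnd]; omega
  · have := h.dichotomy ha hb i
    have := h.le i
    simp only [skewEnd]; omega

theorem IsShape.anti {a : ℕ → ℕ} (ha : IsShape a) {i i' : ℕ} (h : i ≤ i') :
    a i' ≤ a i ∨ a i' = i' := by
  induction i', h using Nat.le_induction with
  | base => exact Or.inl le_rfl
  | succ k _ ih =>
    have := ha.le (k + 1)
    have := ha.le k
    have := ha.succ k
    omega

section

variable {N M A B S S' o o' c c' Kx Sx ox cx Ky Sy oy cy : ℕ} {a b : ℕ → ℕ}

theorem RookStrip.bounds (ha : IsShape a) (hb : IsShape b) (h : RookStrip a b) (i : ℕ) :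
    i ≤ a i ∧ a i ≤ b i ∧ b i ≤ a i + 1 ∧ i + 1 ≤ b (i + 1) ∧
    (a i = i ∧ a (i + 1) = i + 1 ∧ b (i + 1) = i + 1 ∨ i < a i ∧ b (i + 1) ≤ a i) :=
  ⟨ha.le i, h.le i, h.le_succ i, hb.le (i + 1), h.dichotomy ha hb i⟩

theorem RowStep.quiet_zero (ha : IsShape a) (hb : IsShape b) (h : RookStrip a b) (hA : A = a 0)
    (hB : B = b 0) (hS : b 0 < S) (hS' : S' = S) (ho' : o' = o) (hc' : c' = c) (hM : S + c ≤ M)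
    (ho : 0 < o) (hoa : o ≤ a 0 + c)
    (hy : a 0 < b 0 → Ky < b 0 ∧ cy = c ∨ Ky = b 0 ∧ oy = b 0 + c)
    (hoy : a 0 = b 0 → o < oy ∨ Ky < a 0) (hKy : o ≤ Ky) (hKy' : Ky ≤ b 0 + 1)
    (hSy : Sy = b 0 + 1) :
    RowStep M (fun _ => 0) (growthRow M A S o c) (growthRow M B S' o' c')
      (growthRow M Ky Sy oy cy) := by
  subst hA hB hS' ho' hc'
  have := h.bounds ha hb 0
  obtain hab | hab : b 0 = a 0 ∨ b 0 = a 0 + 1 := by omega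
  · have := growthRow_cases M Ky Sy oy cy (a 0)
    apply RowStep.stay <;> omega
  · have := growthRow_cases M Ky Sy oy cy (a 0 + 1)
    apply RowStep.advance <;> omega

theorem RowStep.quiet_succ (ha : IsShape a) (hb : IsShape b) (h : RookStrip a b) (i : ℕ)
    (hA : A = a (i + 1)) (hB : B = b (i + 1)) (hS : S = a i + 1) (hS' : S' = b i + 1)
    (ho' : o' = o) (hc' : c' = c) (hM : b i + 1 + c ≤ M ∨ b i = i) (ho : 0 < o)
    (hoa : o ≤ a (i + 1) + c) (hdiag : a (i + 1) = a i + 1 → o = a i + 1 + c)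
    (hx : a i < b i → (Kx = a i ∧ cx = c ∨ Kx = a i + 1 ∧ ox = a i + 1 + c) ∧ b i < Sx)
    (hKx : a i ≤ Kx) (hox : ox ≤ o ∨ b (i + 1) < Kx) (hSx : a i < Sx ∨ a i = i)
    (hy : a (i + 1) < b (i + 1) → Ky < b (i + 1) ∧ cy = c ∨ Ky = b (i + 1) ∧ oy = b (i + 1) + c)
    (hoy : a (i + 1) = b (i + 1) → o < oy ∨ Ky < a (i + 1)) (hKy : o ≤ Ky)
    (hKy' : Ky ≤ b (i + 1) + 1) (hSy : Sy = b (i + 1) + 1) :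
    RowStep M (growthRow M Kx Sx ox cx) (growthRow M A S o c) (growthRow M B S' o' c')
      (growthRow M Ky Sy oy cy) := by
  subst hA hB hS hS' ho' hc' hSy
  have := h.bounds ha hb (i + 1)
  have := h.bounds ha hb i
  have := growthRow_cases M Kx Sx ox cx (a i + 1)
  obtain hS | ⟨hab, hlt⟩ | hab : a (i + 1) = a i + 1 ∨
    b (i + 1) = a (i + 1) ∧ a (i + 1) ≤ a i ∨ b (i + 1) = a (i + 1) + 1 := by omega
  · apply RowStep.blank <;> omega
  · have := growthRow_cases M Ky (b (i + 1) + 1) oy cy (a (i + 1))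
    apply RowStep.stay <;> omega
  · have hxK : growthRow M Kx Sx ox cx (a (i + 1)) = 0 := by
      have := growthRow_cases M Kx Sx ox cx (a (i + 1))
      omega
    have hxK' : growthRow M Kx Sx ox cx (a (i + 1) + 1) ≤ o' := by
      have := growthRow_cases M Kx Sx ox cx (a (i + 1) + 1)
      omega
    have hyK : growthRow M Ky (b (i + 1) + 1) oy cy (a (i + 1) + 1) = a (i + 1) + 1 + c' := by
      have := growthRow_cases M Ky (b (i + 1) + 1) oy cy (a (i + 1) + 1)
      omega
    apply RowStep.advance <;> omega

/-- The rows of the growth diagram before the insertion starts. -/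
def freshLabel (N : ℕ) (a : ℕ → ℕ) (i : ℕ) : ℕ → ℕ :=
  growthRow (N + 1) (a i) (skewEnd N a i) (i + 1) 1

theorem slideStep_fresh (ha : IsShape a) (hb : IsShape b) (h : RookStrip a b) (hN : b 0 < N) :
    SlideStep (N + 1) (freshLabel N a) (freshLabel N b) := by
  refine .of_rowStep ?_ fun i => ?_
  all_goals simp only [freshLabel, skewEnd_zero, skewEnd_succ]
  · have := h.bounds ha hb 0
    apply RowStep.quiet_zero ha hb h <;> omega
  · have := h.bounds ha hb i
    have := h.bounds ha hb (i + 1)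
    have := h.lt_skewEnd ha hb hN i
    have := hb.anti i.zero_le
    apply RowStep.quiet_succ ha hb h i <;> omega

end

/-- The first nonzero entry of row `i` while a letter is inserted into row `p`. -/
def rowCorner (K : ℕ → ℕ) (p i : ℕ) : ℕ :=
  if i = p ∧ K i = p then p else i + 1

/-- The difference of the entry and the column in the rest of row `i` while a letter is inserted
into row `p`. -/
def rowShift (p i : ℕ) : ℕ :=
  if i ≤ p then 0 else 1

/-- The rows of the growth diagram while a letter is inserted into row `p`. -/
def rowLabel (N : ℕ) (a K : ℕ → ℕ) (p i : ℕ) : ℕ → ℕ :=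
  growthRow (N + 1) (K i) (skewEnd (N + 1) a i) (rowCorner K p i) (rowShift p i)

/-- The shape with row ends `K` arises from the one with row ends `a` by adding at most one box, at
the end of row `p`, and it leaves room for the insertion of a letter into row `p`. -/
structure RowState (a K : ℕ → ℕ) (p : ℕ) : Prop where
  eq (i : ℕ) (h : i ≠ p) : K i = a i
  le : a p ≤ K p
  le_succ : K p ≤ a p + 1
  up (i : ℕ) (h : p = i + 1) : K p ≤ a i
  nondiag (i : ℕ) (h : i < p) : p + 1 ≤ a i
  zero : 1 ≤ K 0

section

variable {N p i : ℕ} {a b K K' : ℕ → ℕ}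

theorem RowState.lt_skewEnd (hK : RowState a K p) (hN : a 0 < N) :
    K p < skewEnd (N + 1) a p := by
  have := hK.le_succ
  rcases p with _ | p
  · simp only [skewEnd]; omega
  · have := hK.up p rfl
    simp only [skewEnd]; omega

theorem RowState.above (hK : RowState a K p) (hi : i < p) :
    K i = a i ∧ p < a i ∧ rowCorner K p i = i + 1 ∧ rowShift p i = 0 :=
  ⟨hK.eq i hi.ne, hK.nondiag i hi, if_neg fun h => hi.ne h.1, if_pos hi.le⟩

theorem RowState.current (hK : RowState a K p) :
    a p ≤ K p ∧ K p ≤ a p + 1 ∧ rowShift p p = 0 ∧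
    (K p = p ∧ rowCorner K p p = p ∨ K p ≠ p ∧ rowCorner K p p = p + 1) := by
  refine ⟨hK.le, hK.le_succ, if_pos le_rfl, ?_⟩
  unfold rowCorner
  split_ifs <;> omega

theorem RowState.below (hK : RowState a K p) (hi : p < i) :
    K i = a i ∧ rowCorner K p i = i + 1 ∧ rowShift p i = 1 :=
  ⟨hK.eq i hi.ne', if_neg fun h => hi.ne' h.1, if_neg hi.not_ge⟩

theorem slideStep_start (ha : IsShape a) (hb : IsShape b) (h : RookStrip a b) (hN : b 0 < N)
    (hK' : RowState b K' 0) (hs : K' 0 = b 0 + 1 ↔ b 0 = a 0) :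
    SlideStep (N + 1) (freshLabel N a) (rowLabel N b K' 0) := by
  refine .of_rowStep ?_ fun i => ?_
  all_goals simp only [freshLabel, rowLabel, skewEnd_zero, skewEnd_succ]
  · have := h.bounds ha hb 0
    have := hK'.current
    have := hK'.zero
    apply RowStep.activate_advance <;> lia
  · have := h.bounds ha hb i
    have := h.bounds ha hb (i + 1)
    have := h.lt_skewEnd ha hb hN i
    have := hb.anti i.zero_le
    have := hK'.below i.add_one_pos
    have := hK'.below (i + 1).add_one_pos
    apply RowStep.quiet_succ ha hb h i <;> lia

theorem rowStep_row_stay_of_lt (ha : IsShape a) (hb : IsShape b) (h : RookStrip a b) (hN : b 0 < N)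
    (hK : RowState a K p) (hK' : RowState b K' p) (hp : b p = a p) (hs : K' p = K p)
    (hi : i + 1 < p) :
    RowStep (N + 1) (rowLabel N a K p i) (rowLabel N a K p (i + 1)) (rowLabel N b K' p (i + 1))
      (rowLabel N b K' p (i + 1 + 1)) := by
  simp only [rowLabel, skewEnd_succ]
  have := h.bounds ha hb i
  have := h.bounds ha hb (i + 1)
  have := h.lt_skewEnd (N := N + 1) ha hb (by omega) i
  have := hb.anti i.zero_le
  have := hK.above hi
  have := hK'.above hi
  have := hK.above ((lt_add_one i).trans hi)
  obtain rfl | hi := eq_or_ne p (i + 1 + 1)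
  · have := hK.up (i + 1) rfl
    have := hK.current
    have := hK'.current
    apply RowStep.quiet_succ ha hb h i <;> lia
  · have := hK'.above (show i + 1 + 1 < p by omega)
    apply RowStep.quiet_succ ha hb h i <;> lia

theorem rowStep_row_stay_of_le (ha : IsShape a) (hb : IsShape b) (h : RookStrip a b) (hN : b 0 < N)
    (hK : RowState a K p) (hK' : RowState b K' p) (hp : b p = a p) (hs : K' p = K p)
    (hi : p ≤ i) :
    RowStep (N + 1) (rowLabel N a K p i) (rowLabel N a K p (i + 1)) (rowLabel N b K' p (i + 1))
      (rowLabel N b K' p (i + 1 + 1)) := by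
  simp only [rowLabel, skewEnd_succ]
  have := h.bounds ha hb i
  have := h.bounds ha hb (i + 1)
  have := h.lt_skewEnd (N := N + 1) ha hb (by omega) i
  have := hb.anti i.zero_le
  have := hK.below (show p < i + 1 by omega)
  have := hK'.below (show p < i + 1 by omega)
  have := hK'.below (show p < i + 1 + 1 by omega)
  obtain rfl | hi := hi.eq_or_lt
  · have := hK.current
    have := hK'.current
    apply RowStep.quiet_succ ha hb h p <;> lia
  · have := hK.below hi
    apply RowStep.quiet_succ ha hb h i <;> lia

theorem slideStep_row_stay (ha : IsShape a) (hb : IsShape b) (h : RookStrip a b) (hN : b 0 < N)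
    (hK : RowState a K p) (hK' : RowState b K' p) (hp : b p = a p) (hs : K' p = K p) :
    SlideStep (N + 1) (rowLabel N a K p) (rowLabel N b K' p) := by
  have := hK.current
  have := hK'.current
  refine .of_rowStep ?_ fun i => ?_
  · simp only [rowLabel, skewEnd_zero, skewEnd_succ]
    have := h.bounds ha hb 0
    have := hK'.zero
    obtain rfl | hp := p.eq_zero_or_pos
    · have := hK'.below Nat.one_pos
      have := growthRow_cases (N + 1) (K' (0 + 1)) (b 0 + 1) (rowCorner K' 0 (0 + 1))
        (rowShift 0 (0 + 1)) (K 0)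
      apply RowStep.stay <;> lia
    · have := hK.above hp
      have := hK'.above hp
      obtain rfl | hp := eq_or_ne p 1
      · have := hK.up 0 rfl
        apply RowStep.quiet_zero ha hb h <;> lia
      · have := hK'.above (show 0 + 1 < p by omega)
        apply RowStep.quiet_zero ha hb h <;> lia
  · obtain hi | rfl | hi := lt_trichotomy p (i + 1)
    · exact rowStep_row_stay_of_le ha hb h hN hK hK' hp hs (Nat.le_of_lt_succ hi)
    · have := h.bounds ha hb i
      have := h.bounds ha hb (i + 1)
      have := h.lt_skewEnd (N := N + 1) ha hb (by omega) i
      have := hb.anti i.zero_le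
      simp only [rowLabel, skewEnd_succ]
      have : rowCorner K' (i + 1) (i + 1) = rowCorner K (i + 1) (i + 1) := by omega
      have := hK.up i rfl
      have := hK.above (lt_add_one i)
      have := hK'.below (lt_add_one (i + 1))
      have := growthRow_cases (N + 1) (K' (i + 1 + 1)) (b (i + 1) + 1)
        (rowCorner K' (i + 1) (i + 1 + 1)) (rowShift (i + 1) (i + 1 + 1)) (K (i + 1))
      have := growthRow_cases (N + 1) (K i) (skewEnd (N + 1) a i) (rowCorner K (i + 1) i)
        (rowShift (i + 1) i) (a i + 1)
      apply RowStep.stay <;> lia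
    · exact rowStep_row_stay_of_lt ha hb h hN hK hK' hp hs hi

theorem rowStep_row_row_of_lt (ha : IsShape a) (hb : IsShape b) (h : RookStrip a b) (hN : b 0 < N)
    (hK : RowState a K p) (hK' : RowState b K' (p + 1)) (hp : b p = a p + 1) (hd : p < a p)
    (hs : K' (p + 1) = b (p + 1) + 1 ↔ b (p + 1) ≤ a (p + 1) ∧ b (p + 1) < K p) (hi : i < p) :
    RowStep (N + 1) (rowLabel N a K p i) (rowLabel N a K p (i + 1))
      (rowLabel N b K' (p + 1) (i + 1)) (rowLabel N b K' (p + 1) (i + 1 + 1)) := by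
  simp only [rowLabel, skewEnd_succ]
  have := h.bounds ha hb i
  have := h.bounds ha hb (i + 1)
  have := h.lt_skewEnd (N := N + 1) ha hb (by omega) i
  have := hb.anti i.zero_le
  have := hK.current
  have := hK.above hi
  have := hK'.above (show i + 1 < p + 1 by omega)
  have := hK'.above (lt_add_one p)
  obtain rfl | hi := eq_or_ne p (i + 1)
  · have := hK.up i rfl
    have := hK'.current
    by_cases hKi : K (i + 1) = a (i + 1)
    · apply RowStep.quiet_succ ha hb h i <;> lia
    · have : b i < N ∧ K (i + 1) = b (i + 1) ∧ rowCorner K (i + 1) (i + 1) = i + 2 := by omega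
      have := growthRow_cases (N + 1) (K' (i + 1 + 1)) (b (i + 1) + 1)
        (rowCorner K' (i + 1 + 1) (i + 1 + 1)) (rowShift (i + 1 + 1) (i + 1 + 1)) (K (i + 1))
      have := growthRow_cases (N + 1) (K i) (skewEnd (N + 1) a i) (rowCorner K (i + 1) i)
        (rowShift (i + 1) i) (a i + 1)
      apply RowStep.stay <;> lia
  · have := hK.above (show i + 1 < p by omega)
    have := hK'.above (show i + 1 + 1 < p + 1 by omega)
    apply RowStep.quiet_succ ha hb h i <;> lia

theorem rowStep_row_row_self (ha : IsShape a) (hb : IsShape b) (h : RookStrip a b) (hN : b 0 < N)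
    (hK : RowState a K p) (hK' : RowState b K' (p + 1)) (hp : b p = a p + 1) (hd : p < a p)
    (hs : K' (p + 1) = b (p + 1) + 1 ↔ b (p + 1) ≤ a (p + 1) ∧ b (p + 1) < K p) :
    RowStep (N + 1) (rowLabel N a K p p) (rowLabel N a K p (p + 1))
      (rowLabel N b K' (p + 1) (p + 1)) (rowLabel N b K' (p + 1) (p + 1 + 1)) := by
  simp only [rowLabel, skewEnd_succ]
  have := h.bounds ha hb p
  have := h.bounds ha hb (p + 1)
  have := h.lt_skewEnd (N := N + 1) ha hb (by omega) p
  have := hb.anti p.zero_le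
  have := hK.current
  have := hK'.current
  have := hK'.above (lt_add_one p)
  have := hK.below (lt_add_one p)
  have := hK'.below (lt_add_one (p + 1))
  have : b p ≤ b 0 := by omega
  have hx (j : ℕ) := growthRow_cases (N + 1) (K p) (skewEnd (N + 1) a p) (rowCorner K p p)
    (rowShift p p) j
  by_cases hK'p : K' (p + 1) = a (p + 1)
  · have : K p = a p ∧ a (p + 1) = a p ∧ b (p + 1) = a p := by omega
    have := hx (K (p + 1))
    have := hx (K (p + 1) + 1)
    have := growthRow_cases (N + 1) (K' (p + 1 + 1)) (b (p + 1) + 1)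
      (rowCorner K' (p + 1) (p + 1 + 1)) (rowShift (p + 1) (p + 1 + 1)) (K (p + 1))
    apply RowStep.activate_stay <;> lia
  · have : K' (p + 1) = K (p + 1) + 1 ∧ K (p + 1) < K p := by omega
    have := hx (K (p + 1))
    have := hx (K (p + 1) + 1)
    apply RowStep.activate_advance
    case hxS =>
      intro j _ _
      have := hx j
      lia
    all_goals lia

theorem slideStep_row_row (ha : IsShape a) (hb : IsShape b) (h : RookStrip a b) (hN : b 0 < N)
    (hK : RowState a K p) (hK' : RowState b K' (p + 1)) (hp : b p = a p + 1) (hd : p < a p)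
    (hs : K' (p + 1) = b (p + 1) + 1 ↔ b (p + 1) ≤ a (p + 1) ∧ b (p + 1) < K p) :
    SlideStep (N + 1) (rowLabel N a K p) (rowLabel N b K' (p + 1)) := by
  refine .of_rowStep ?_ fun i => ?_
  · simp only [rowLabel, skewEnd_zero, skewEnd_succ]
    have := h.bounds ha hb 0
    have := hK.zero
    have := hK.current
    have := hK'.current
    have := hK'.above (lt_add_one p)
    obtain rfl | hp := p.eq_zero_or_pos
    · by_cases hK0 : K 0 = a 0
      · apply RowStep.quiet_zero ha hb h <;> lia
      · have := growthRow_cases (N + 1) (K' (0 + 1)) (b 0 + 1) (rowCorner K' (0 + 1) (0 + 1))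
          (rowShift (0 + 1) (0 + 1)) (K 0)
        apply RowStep.stay <;> lia
    · have := hK.above hp
      have := hK'.above (hp.trans (lt_add_one p))
      have := hK'.above (Nat.add_lt_add_right hp 1)
      apply RowStep.quiet_zero ha hb h <;> lia
  · obtain hi | rfl | hi := lt_trichotomy p i
    · simp only [rowLabel, skewEnd_succ]
      have := h.bounds ha hb i
      have := h.bounds ha hb (i + 1)
      have := h.lt_skewEnd (N := N + 1) ha hb (by omega) i
      have := hb.anti i.zero_le
      have := hK.below hi
      have := hK.below (hi.trans (lt_add_one i))
      have := hK'.below (show p + 1 < i + 1 by omega)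
      have := hK'.below (show p + 1 < i + 1 + 1 by omega)
      apply RowStep.quiet_succ ha hb h i <;> lia
    · exact rowStep_row_row_self ha hb h hN hK hK' hp hd hs
    · exact rowStep_row_row_of_lt ha hb h hN hK hK' hp hd hs hi

end

/-- The first nonzero entry of row `i` while a letter is inserted into column `s`. -/
def colCorner (a K : ℕ → ℕ) (s i : ℕ) : ℕ :=
  if K i ≠ a i then K i else if K i ≤ s then i else i + 1

/-- The rows of the growth diagram while a letter is inserted into column `s`. -/
def colLabel (N : ℕ) (a K : ℕ → ℕ) (s i : ℕ) : ℕ → ℕ :=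
  growthRow (N + 1) (K i) (skewEnd (N + 1) a i) (colCorner a K s i) 0

/-- The row ends `a` of the labels so far and the row ends `K` of the tableau into which they have
been inserted, while a letter is inserted into column `s`. -/
structure ColState (a K : ℕ → ℕ) (s : ℕ) : Prop where
  diag (i : ℕ) (h : s ≤ i) : a i = i
  eq (i : ℕ) : K i = a i ∨ (K i = s + 1 ∧ a i = s)
  up (i : ℕ) : K (i + 1) = a (i + 1) ∨ s < a i
  zero : s + 1 ≤ K 0

section

variable {N p s i : ℕ} {a b K K' : ℕ → ℕ}

theorem ColState.lt_skewEnd (hK : ColState a K s) (hN : a 0 < N) (i : ℕ) :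
    K i = a i ∨ K i < skewEnd (N + 1) a i := by
  have := hK.eq i
  rcases i with _ | i
  · simp only [skewEnd]; omega
  · have := hK.up i
    simp only [skewEnd]; omega

theorem ColState.cases (hK : ColState a K s) (i : ℕ) :
    (K i = a i ∧ a i ≤ s ∧ colCorner a K s i = i) ∨
    (K i = a i ∧ s < a i ∧ colCorner a K s i = i + 1) ∨
    (K i = s + 1 ∧ a i = s ∧ colCorner a K s i = s + 1) := by
  have := hK.eq i
  unfold colCorner
  split_ifs <;> omega

theorem RowState.colState (ha : IsShape a) (hK : RowState a K p) (hd : a p = p) :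
    ColState a K p where
  diag i hi := by
    have := ha.anti hi
    have := ha.le i
    omega
  eq i := by
    have := hK.current
    obtain rfl | hi := eq_or_ne i p
    · omega
    · exact .inl (hK.eq i hi)
  up i := by
    obtain rfl | hi := eq_or_ne (i + 1) p
    · exact .inr (hK.nondiag i i.lt_add_one)
    · exact .inl (hK.eq _ hi)
  zero := by
    obtain rfl | hp := p.eq_zero_or_pos
    · exact hK.zero
    · have := hK.above hp
      omega

theorem rowLabel_eq_colLabel (ha : IsShape a) (hK : RowState a K p) (hd : a p = p) :
    rowLabel N a K p = colLabel N a K p := by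
  funext i
  have hc := (hK.colState ha hd).cases i
  obtain hi | rfl | hi := lt_trichotomy i p
  · have := hK.above hi
    rw [rowLabel, colLabel, show rowCorner K p i = colCorner a K p i by omega, this.2.2.2]
  · have := hK.current
    rw [rowLabel, colLabel, show rowCorner K i i = colCorner a K i i by omega, this.2.2.1]
  · have hdiag := (hK.colState ha hd).diag
    obtain ⟨i, rfl⟩ : ∃ i', i = i' + 1 := ⟨i - 1, by omega⟩
    have := hdiag i (by omega)
    have := hdiag (i + 1) hi.le
    have := hK.below hi
    funext j
    rw [rowLabel, colLabel, skewEnd_succ]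
    have := growthRow_cases (N + 1) (K (i + 1)) (a i + 1) (rowCorner K p (i + 1))
      (rowShift p (i + 1)) j
    have := growthRow_cases (N + 1) (K (i + 1)) (a i + 1) (colCorner a K p (i + 1)) 0 j
    omega

theorem rowStep_col_stay (ha : IsShape a) (hb : IsShape b) (h : RookStrip a b) (hN : b 0 < N)
    (hK : ColState a K s) (hK' : ColState b K' s) (hp : ∀ i, a i = s → b i = s)
    (hs : ∀ i, K' i = max (K i) (b i)) :
    RowStep (N + 1) (colLabel N a K s i) (colLabel N a K s (i + 1)) (colLabel N b K' s (i + 1))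
      (colLabel N b K' s (i + 1 + 1)) := by
  simp only [colLabel, skewEnd_succ]
  obtain hi | hi := le_or_gt s i
  · have := hK.eq (i + 1)
    have := hK'.eq (i + 1)
    have := hK.diag i hi
    have := hK.diag (i + 1) (by omega)
    have := hK'.diag i hi
    have := hK'.diag (i + 1) (by omega)
    apply RowStep.blank <;> lia
  have := h.bounds ha hb i
  have := h.bounds ha hb (i + 1)
  have := h.lt_skewEnd (N := N + 1) ha hb (by omega) i
  have := hb.anti i.zero_le
  have := hK.cases i
  have := hK'.cases (i + 1)
  have := hK'.cases (i + 1 + 1)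
  have := hK.up i
  have := hK'.up (i + 1)
  have := hp i
  have := hp (i + 1)
  have := hs (i + 1)
  obtain hKi | hKi | hKi := hK.cases (i + 1)
  · have : b (i + 1) ≤ s ∧ K' (i + 1) = b (i + 1) := by omega
    apply RowStep.quiet_succ ha hb h i <;> lia
  · have : s < b (i + 1) ∧ s < a i ∧ i < a i ∧ K' (i + 1) = b (i + 1) := by omega
    apply RowStep.quiet_succ ha hb h i <;> lia
  · have : b i < N ∧ b (i + 1) = s ∧ K' (i + 1) = s + 1 := by omega
    have : K i = a i ∧ b i < skewEnd (N + 1) a i ∧ K' (i + 1 + 1) ≤ s + 2 := by omega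
    have := growthRow_cases (N + 1) (K' (i + 1 + 1)) (b (i + 1) + 1)
      (colCorner b K' s (i + 1 + 1)) 0 (K (i + 1))
    have := growthRow_cases (N + 1) (K i) (skewEnd (N + 1) a i) (colCorner a K s i) 0 (a i + 1)
    apply RowStep.stay <;> lia

theorem slideStep_col_stay (ha : IsShape a) (hb : IsShape b) (h : RookStrip a b) (hN : b 0 < N)
    (hK : ColState a K s) (hK' : ColState b K' s) (hp : ∀ i, a i = s → b i = s)
    (hs : ∀ i, K' i = max (K i) (b i)) :
    SlideStep (N + 1) (colLabel N a K s) (colLabel N b K' s) := by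
  refine .of_rowStep ?_ fun i => rowStep_col_stay ha hb h hN hK hK' hp hs
  simp only [colLabel, skewEnd_zero, skewEnd_succ]
  have := h.bounds ha hb 0
  have := hK.cases 0
  have := hK'.cases 0
  have := hK'.cases (0 + 1)
  have := hK.zero
  have := hK'.up 0
  have := hp 0
  have := hs 0
  obtain hK0 | hK0 := eq_or_ne (K 0) (a 0)
  · apply RowStep.quiet_zero ha hb h <;> lia
  · have := growthRow_cases (N + 1) (K' (0 + 1)) (b 0 + 1) (colCorner b K' s (0 + 1)) 0 (K 0)
    apply RowStep.stay <;> lia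

theorem rowStep_col_col_of_le (ha : IsShape a) (hb : IsShape b) (h : RookStrip a b) (hN : b 0 < N)
    (hK : ColState a K s) (hK' : ColState b K' (s + 1)) (hi : a i ≤ s ∨ a i = i) :
    RowStep (N + 1) (colLabel N a K s i) (colLabel N a K s (i + 1))
      (colLabel N b K' (s + 1) (i + 1)) (colLabel N b K' (s + 1) (i + 1 + 1)) := by
  simp only [colLabel, skewEnd_succ]
  have := h.bounds ha hb i
  have := h.bounds ha hb (i + 1)
  have := h.lt_skewEnd (N := N + 1) ha hb (by omega) i
  have := hb.anti i.zero_le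
  have : K (i + 1) = a (i + 1) ∧ K' (i + 1) = b (i + 1) := by
    have := hK.eq (i + 1)
    have := hK.up i
    have := hK'.eq (i + 1)
    have := hK'.up i
    have := hK.diag i
    have := hK.diag (i + 1)
    omega
  have := hK.cases i
  have := hK.cases (i + 1)
  have := hK'.cases (i + 1)
  obtain hd | hd : a (i + 1) = a i + 1 ∨ a (i + 1) ≤ a i ∧ a (i + 1) ≤ s := by
    have := ha.succ i
    omega
  · have := growthRow_cases (N + 1) (K i) (skewEnd (N + 1) a i) (colCorner a K s i) 0 (a i + 1)
    have := hK'.diag i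
    have : b i = a i ∨ i < b i ∧ colCorner b K' (s + 1) (i + 1) = i + 1 := by omega
    apply RowStep.blank <;> lia
  · have := hK'.cases (i + 1 + 1)
    have := hK'.up (i + 1)
    apply RowStep.quiet_succ ha hb h i <;> lia

theorem rowStep_col_col_of_lt (ha : IsShape a) (hb : IsShape b) (h : RookStrip a b) (hN : b 0 < N)
    (hK : ColState a K s) (hK' : ColState b K' (s + 1)) (his : i + 1 < s)
    (hi : s < a (i + 1)) (hbi : s + 1 ≤ b (i + 1 + 1))
    (hs : b (i + 1) = s + 1 → (K' (i + 1) = s + 2 ↔ s + 1 < K i)) :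
    RowStep (N + 1) (colLabel N a K s i) (colLabel N a K s (i + 1))
      (colLabel N b K' (s + 1) (i + 1)) (colLabel N b K' (s + 1) (i + 1 + 1)) := by
  simp only [colLabel, skewEnd_succ]
  have := h.bounds ha hb i
  have := h.bounds ha hb (i + 1)
  have := h.lt_skewEnd (N := N + 1) ha hb (by omega) i
  have := hb.anti i.zero_le
  have : K (i + 1) = a (i + 1) ∧ K i = a i ∧ s < a i := by
    have := hK.eq i
    have := hK.eq (i + 1)
    omega
  have := hK.cases i
  have := hK.cases (i + 1)
  have := hK'.cases (i + 1)
  have : K' (i + 1 + 1) ≤ b (i + 1) ∧ b i < N ∧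
    (K' (i + 1 + 1) = b (i + 1 + 1) ∨ s + 1 < b (i + 1) ∧ K' (i + 1 + 1) = s + 2) := by
    have := hK'.eq (i + 1 + 1)
    have := hK'.up (i + 1)
    omega
  have := hK'.cases (i + 1 + 1)
  obtain hb1 | hb1 := eq_or_ne (b (i + 1)) (s + 1)
  · have := growthRow_cases (N + 1) (K' (i + 1 + 1)) (b (i + 1) + 1)
      (colCorner b K' (s + 1) (i + 1 + 1)) 0 (K (i + 1))
    have hx (j : ℕ) := growthRow_cases (N + 1) (K i) (skewEnd (N + 1) a i) (colCorner a K s i) 0 j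
    have := hx (a i + 1)
    have := hx (K (i + 1))
    obtain hK'1 | hK'1 := eq_or_ne (K' (i + 1)) (s + 2)
    · apply RowStep.grow <;> lia
    · have : K i = s + 1 ∧ K (i + 1) = s + 1 ∧ K' (i + 1) = s + 1 := by omega
      have : colCorner b K' (s + 1) (i + 1) = i + 1 := by omega
      have : growthRow (N + 1) (K i) (skewEnd (N + 1) a i) (colCorner a K s i) 0 (K (i + 1)) =
        i + 1 := by omega
      have : growthRow (N + 1) (K' (i + 1 + 1)) (b (i + 1) + 1)
        (colCorner b K' (s + 1) (i + 1 + 1)) 0 (K (i + 1)) = colCorner a K s (i + 1) := by omega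
      apply RowStep.stay <;> lia
  · apply RowStep.quiet_succ ha hb h i <;> lia

theorem rowStep_col_col_of_eq (ha : IsShape a) (hb : IsShape b) (h : RookStrip a b) (hN : b 0 < N)
    (hK : ColState a K s) (hK' : ColState b K' (s + 1)) (his : i + 1 ≤ s)
    (hi : a (i + 1) = s) (hbi : b (i + 1) = s + 1)
    (hs : K' (i + 1) = s + 2 ↔ s + 1 ≤ K (i + 1) ∧ s + 1 < K i) :
    RowStep (N + 1) (colLabel N a K s i) (colLabel N a K s (i + 1))
      (colLabel N b K' (s + 1) (i + 1)) (colLabel N b K' (s + 1) (i + 1 + 1)) := by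
  simp only [colLabel, skewEnd_succ]
  have := h.bounds ha hb i
  have := h.bounds ha hb (i + 1)
  have := h.lt_skewEnd (N := N + 1) ha hb (by omega) i
  have := hb.anti i.zero_le
  have : K i = a i ∧ s < a i ∧ b i < N := by
    have := hK.eq i
    omega
  have : K' (i + 1 + 1) = b (i + 1 + 1) ∧ b (i + 1 + 1) ≤ s + 1 := by
    have := hK'.eq (i + 1 + 1)
    have := hK'.up (i + 1)
    omega
  have := hK.cases i
  have := hK'.cases (i + 1)
  have := hK'.cases (i + 1 + 1)
  obtain hK1 | hK1 | hK1 := hK.cases (i + 1)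
  · apply RowStep.quiet_succ ha hb h i <;> lia
  · omega
  · have := growthRow_cases (N + 1) (K' (i + 1 + 1)) (b (i + 1) + 1)
      (colCorner b K' (s + 1) (i + 1 + 1)) 0 (K (i + 1))
    have hx (j : ℕ) := growthRow_cases (N + 1) (K i) (skewEnd (N + 1) a i) (colCorner a K s i) 0 j
    have := hx (a i + 1)
    have := hx (K (i + 1))
    obtain hK'1 | hK'1 := eq_or_ne (K' (i + 1)) (s + 2)
    · apply RowStep.grow <;> lia
    · have : K i = s + 1 ∧ K (i + 1) = s + 1 ∧ K' (i + 1) = s + 1 := by omega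
      have : colCorner b K' (s + 1) (i + 1) = i + 1 := by omega
      have : growthRow (N + 1) (K i) (skewEnd (N + 1) a i) (colCorner a K s i) 0 (K (i + 1)) =
        i + 1 := by omega
      have : growthRow (N + 1) (K' (i + 1 + 1)) (b (i + 1) + 1)
        (colCorner b K' (s + 1) (i + 1 + 1)) 0 (K (i + 1)) = colCorner a K s (i + 1) := by omega
      apply RowStep.stay <;> lia

theorem rowStep_col_col_zero (ha : IsShape a) (hb : IsShape b) (h : RookStrip a b) (hN : b 0 < N)
    (hK : ColState a K s) (hK' : ColState b K' (s + 1)) (h0 : a 0 = s ∨ s + 1 ≤ b (0 + 1)) :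
    RowStep (N + 1) (fun _ => 0) (colLabel N a K s 0) (colLabel N b K' (s + 1) 0)
      (colLabel N b K' (s + 1) (0 + 1)) := by
  simp only [colLabel, skewEnd_zero, skewEnd_succ]
  have := h.bounds ha hb 0
  have := hK'.cases 0
  have := hK'.cases (0 + 1)
  have := hK.zero
  have := hK'.zero
  have := hK'.up 0
  have := growthRow_cases (N + 1) (K' (0 + 1)) (b 0 + 1) (colCorner b K' (s + 1) (0 + 1)) 0 (K 0)
  obtain hK0 | hK0 | hK0 := hK.cases 0
  · omega
  · obtain hb0 | hb0 := eq_or_ne (b 0) (s + 1)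
    · apply RowStep.grow <;> lia
    · apply RowStep.quiet_zero ha hb h <;> lia
  · apply RowStep.grow <;> lia

theorem slideStep_col_col (ha : IsShape a) (hb : IsShape b) (h : RookStrip a b)
    (hN : b 0 < N) (hK : ColState a K s) (hK' : ColState b K' (s + 1)) {f : ℕ} (hf : a f = s)
    (hf' : b f = s + 1)
    (hs : ∀ i, b i = s + 1 → i ≤ s →
      (K' i = s + 2 ↔ s + 1 ≤ K i ∧ ∀ i', i = i' + 1 → s + 1 < K i')) :
    SlideStep (N + 1) (colLabel N a K s) (colLabel N b K' (s + 1)) := by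
  have hfs : f ≤ s := hf ▸ ha.le f
  have hlt (i : ℕ) (hi : i < f) : s < a i := by
    obtain ⟨f, rfl⟩ : ∃ f', f = f' + 1 := ⟨f - 1, by omega⟩
    have := h.succ f
    have := ha.anti (show i ≤ f by omega)
    omega
  have hge (i : ℕ) (hi : f ≤ i) : a i ≤ s ∨ a i = i := hf ▸ ha.anti hi
  have hble (i : ℕ) (hi : i ≤ f) : s + 1 ≤ b i := by
    have := hb.anti hi
    omega
  refine .of_rowStep ?_ fun i => ?_
  · refine rowStep_col_col_zero ha hb h hN hK hK' ?_
    obtain rfl | hf0 := f.eq_zero_or_pos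
    · exact .inl hf
    · exact .inr (hble _ hf0)
  · obtain hi | hi := le_or_gt f i
    · exact rowStep_col_col_of_le ha hb h hN hK hK' (hge i hi)
    · have hs1 := hs (i + 1)
      obtain rfl | hf := eq_or_ne f (i + 1)
      · exact rowStep_col_col_of_eq ha hb h hN hK hK' hfs hf hf' (by simpa using hs1 hf' hfs)
      · refine rowStep_col_col_of_lt ha hb h hN hK hK' (by omega) (hlt _ (by omega))
          (hble _ (by omega)) fun hbi => ?_
        have := hlt (i + 1) (by omega)
        have := hK.eq (i + 1)
        simpa [show s + 1 ≤ K (i + 1) by omega] using hs1 hbi (by omega)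

end

/-! ### Growth diagrams and slides -/

/-- `a < b`, except that the bounds `0` and `M` may be repeated. -/
def StrictBelow (M a b : ℕ) : Prop := a < b ∨ a = 0 ∧ b = 0 ∨ a = M ∧ b = M

/-- A column of a growth diagram: an array on the boxes weakly above the main diagonal with values
in `[0, M]`, in which the rows and columns increase strictly between the bounds. -/
structure IsIncreasingArray (M : ℕ) (U : ℕ → ℕ → ℕ) : Prop where
  le (i j : ℕ) : U i j ≤ M
  row (i j : ℕ) : StrictBelow M (U i j) (U i (j + 1))
  col (i j : ℕ) (h : i < j) : StrictBelow M (U i j) (U (i + 1) j)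
  below (i j : ℕ) (h : j < i) : U i j = 0

theorem StrictBelow.step {M u v u' v' : ℕ} (h : StrictBelow M u v) (hv : v ≤ M) (hu' : u' ≤ u)
    (hv' : v' ≤ v) (huv' : v' < v → u ≤ v') (hlt : 0 < u → u < M → v' = u → u' < u) :
    StrictBelow M u' v' := by
  unfold StrictBelow at *
  omega

section

variable {M k : ℕ} {U V : ℕ → ℕ → ℕ} {i j : ℕ}

theorem SlideStep.le (h : SlideStep M U V) (i j : ℕ) : V i j ≤ U i j :=
  (h i).le j

theorem SlideStep.left_le (h : SlideStep M U V) (hlt : V i (j + 1) < U i (j + 1)) :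
    U i j ≤ V i (j + 1) :=
  (h i).eq_max _ hlt ▸ le_max_left _ _

theorem SlideStep.above_le (h : SlideStep M U V) (hlt : V (i + 1) j < U (i + 1) j) :
    U i j ≤ V (i + 1) j :=
  (h (i + 1)).eq_max _ hlt ▸ le_max_right _ _

theorem SlideStep.lt_iff (h : SlideStep M U V) (h0 : 0 < U i j) (hM : U i j < M) :
    V i j < U i j ↔ V i (j + 1) = U i j ∨ V (i + 1) j = U i j :=
  (h i).lt_iff j h0 hM

theorem SlideStep.isIncreasingArray (h : SlideStep M U V) (hU : IsIncreasingArray M U) :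
    IsIncreasingArray M V where
  le i j := (h.le i j).trans (hU.le i j)
  row i j := (hU.row i j).step (hU.le _ _) (h.le _ _) (h.le _ _) h.left_le
    fun h0 hM e => (h.lt_iff h0 hM).2 (.inl e)
  col i j hij := (hU.col i j hij).step (hU.le _ _) (h.le _ _) (h.le _ _) h.above_le
    fun h0 hM e => (h.lt_iff h0 hM).2 (.inr e)
  below i j hij := Nat.eq_zero_of_le_zero (hU.below i j hij ▸ h.le i j)

theorem Adjacent.symm {a b : Box} (h : Adjacent a b) : Adjacent b a := by
  unfold Adjacent at *
  omega

theorem adjacent_right (i j : ℕ) : Adjacent (i, j) (i, j + 1) := Or.inl ⟨rfl, Or.inl rfl⟩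

theorem adjacent_down (i j : ℕ) : Adjacent (i, j) (i + 1, j) := Or.inr ⟨rfl, Or.inl rfl⟩

theorem adjacent_iff (i j : ℕ) (b : Box) : Adjacent (i, j) b ↔
    b = (i, j + 1) ∨ b = (i + 1, j) ∨ (∃ j', j = j' + 1 ∧ b = (i, j')) ∨
      ∃ i', i = i' + 1 ∧ b = (i', j) := by
  constructor
  · obtain ⟨b1, b2⟩ := b
    rintro (⟨h, h' | h'⟩ | ⟨h, h' | h'⟩) <;> simp only at h h' <;> subst h <;> subst h'
    · exact .inl rfl
    · exact .inr (.inr (.inl ⟨_, rfl, rfl⟩))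
    · exact .inr (.inl rfl)
    · exact .inr (.inr (.inr ⟨_, rfl, rfl⟩))
  · rintro (rfl | rfl | ⟨j', rfl, rfl⟩ | ⟨i', rfl, rfl⟩)
    · exact adjacent_right i j
    · exact adjacent_down i j
    · exact (adjacent_right i j').symm
    · exact (adjacent_down i' j).symm

theorem IsIncreasingArray.strictBelow (hU : IsIncreasingArray M U) {b : Box}
    (hb : b = (i, j + 1) ∨ b = (i + 1, j)) (h0 : 0 < U b.1 b.2) :
    StrictBelow M (U i j) (U b.1 b.2) := by
  rcases hb with rfl | rfl
  · exact hU.row i j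
  · exact hU.col i j (by by_contra hij; exact h0.ne' (hU.below (i + 1) j (by omega)))

/-- When a value drops past `k`, it drops to `k` if and only if `k` occurs next to it, because
it drops to the maximum of the values to its left and above it. -/
theorem SlideStep.eq_iff_adjacent (h : SlideStep M U V) (hU : IsIncreasingArray M U) (hk : 0 < k)
    (hUk : k < U i j) (hVk : V i j ≤ k) :
    V i j = k ↔ ∃ b : Box, Adjacent (i, j) b ∧ U b.1 b.2 = k := by
  have hmax := (h i).eq_max j (by omega)
  constructor
  · intro hV
    rcases le_total (leftOf (U i) j) (rowAbove U i j) with hle | hle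
    · rw [max_eq_right hle] at hmax
      rcases i with _ | i
      · exact absurd (hV.symm.trans hmax) hk.ne'
      · exact ⟨(i, j), (adjacent_down i j).symm, hmax.symm.trans hV⟩
    · rw [max_eq_left hle] at hmax
      rcases j with _ | j
      · exact absurd (hV.symm.trans hmax) hk.ne'
      · exact ⟨(i, j), (adjacent_right i j).symm, hmax.symm.trans hV⟩
  · rintro ⟨b, hb, hbk⟩
    have hUM := hU.le i j
    have hafter (hb : b = (i, j + 1) ∨ b = (i + 1, j)) : V i j = k := by
      have := hU.strictBelow hb (by omega)
      unfold StrictBelow at this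
      omega
    rcases (adjacent_iff i j b).1 hb with hb | hb | ⟨j', rfl, rfl⟩ | ⟨i', rfl, rfl⟩
    · exact hafter (.inl hb)
    · exact hafter (.inr hb)
    · exact hVk.antisymm (hbk ▸ h.left_le (hVk.trans_lt hUk))
    · exact hVk.antisymm (hbk ▸ h.above_le (hVk.trans_lt hUk))

theorem SlideStep.lt_iff_adjacent (h : SlideStep M U V) (hU : IsIncreasingArray M U) (hk : 0 < k)
    (hM : k < M) (hUk : U i j = k) :
    V i j < k ↔ ∃ b : Box, Adjacent (i, j) b ∧ k < U b.1 b.2 ∧ V b.1 b.2 ≤ k := by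
  subst hUk
  rw [h.lt_iff hk hM]
  constructor
  · have hafter {b : Box} (hb : b = (i, j + 1) ∨ b = (i + 1, j)) (hbV : V b.1 b.2 = U i j) :
        U i j < U b.1 b.2 := by
      have hle := h.le b.1 b.2
      have := hU.strictBelow hb (by omega)
      unfold StrictBelow at this
      omega
    rintro (hV | hV)
    · exact ⟨(i, j + 1), adjacent_right i j, hafter (.inl rfl) hV, hV.le⟩
    · exact ⟨(i + 1, j), adjacent_down i j, hafter (.inr rfl) hV, hV.le⟩
  · rintro ⟨b, hb, hUb, hVb⟩
    rcases (adjacent_iff i j b).1 hb with rfl | rfl | ⟨j', rfl, rfl⟩ | ⟨i', rfl, rfl⟩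
    · exact .inl (hVb.antisymm (h.left_le (hVb.trans_lt hUb)))
    · exact .inr (hVb.antisymm (h.above_le (hVb.trans_lt hUb)))
    · have := hU.strictBelow (i := i) (j := j') (.inl rfl) hk
      unfold StrictBelow at this
      simp only at *
      omega
    · have := hU.strictBelow (i := i') (j := j) (.inr rfl) hk
      unfold StrictBelow at this
      simp only at *
      omega

/-- With `∘` in the boxes of value `k`, and the label `r` in those whose value drops from above `k`
to at most `k`, this is the rule by which the switch `(r, ∘)` places `∘`. -/
theorem SlideStep.eq_iff_switch (h : SlideStep M U V) (hU : IsIncreasingArray M U) (hk : 0 < k)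
    (hM : k < M) :
    V i j = k ↔
      ((k < U i j ∧ V i j ≤ k) ∧ ∃ b : Box, Adjacent (i, j) b ∧ U b.1 b.2 = k) ∨
      (U i j = k ∧ ¬ ∃ b : Box, Adjacent (i, j) b ∧ k < U b.1 b.2 ∧ V b.1 b.2 ≤ k) := by
  have hle := h.le i j
  rcases lt_trichotomy (U i j) k with hUk | hUk | hUk
  · omega
  · rw [← h.lt_iff_adjacent hU hk hM hUk]
    omega
  · by_cases hVk : V i j ≤ k
    · rw [← h.eq_iff_adjacent hU hk hUk hVk]
      omega
    · omega

theorem SlideStep.lt_le_iff_switch (h : SlideStep M U V) (hU : IsIncreasingArray M U) (hk : 0 < k)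
    (hM : k < M) :
    k ≤ U i j ∧ V i j < k ↔
      (U i j = k ∧ ∃ b : Box, Adjacent (i, j) b ∧ k < U b.1 b.2 ∧ V b.1 b.2 ≤ k) ∨
      ((k < U i j ∧ V i j ≤ k) ∧ ¬ ∃ b : Box, Adjacent (i, j) b ∧ U b.1 b.2 = k) := by
  rcases lt_trichotomy (U i j) k with hUk | hUk | hUk
  · omega
  · rw [← h.lt_iff_adjacent hU hk hM hUk]
    omega
  · by_cases hVk : V i j ≤ k
    · rw [← h.eq_iff_adjacent hU hk hUk hVk]
      omega
    · omega

end

section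

variable {α : Type} {c d e : α}

theorem switch_eq_some_of_ne (hc : c ≠ e) (hd : d ≠ e) (T : Filling α) (a : Box) :
    switch c d T a = some e ↔ T a = some e := by
  unfold switch
  split_ifs with h1 h2
  · simp [h1.1, hc, hd]
  · simp [h2.1, hc, hd]
  · rfl

theorem switch_comm (hcd : c ≠ d) (T : Filling α) : switch c d T = switch d c T := by
  funext a
  have hne (h1 : T a = some c) (h2 : T a = some d) : False :=
    hcd (Option.some.inj (h1.symm.trans h2))
  unfold switch
  split_ifs with h1 h2 <;> first | rfl | exact (hne h1.1 h2.1).elim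

theorem switch_eq_some_right (hcd : c ≠ d) (T : Filling α) (a : Box) :
    switch c d T a = some d ↔ (T a = some c ∧ ∃ b, Adjacent a b ∧ T b = some d) ∨
      (T a = some d ∧ ¬ ∃ b, Adjacent a b ∧ T b = some c) := by
  unfold switch
  split_ifs with h1 h2
  · simp only [h1, true_and, true_or]
  · simp only [h2, not_true, and_false, or_false, Option.some.injEq, hcd, hcd.symm, false_and]
  · grind

theorem switch_eq_some_left (hcd : c ≠ d) (T : Filling α) (a : Box) :
    switch c d T a = some c ↔ (T a = some d ∧ ∃ b, Adjacent a b ∧ T b = some c) ∨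
      (T a = some c ∧ ¬ ∃ b, Adjacent a b ∧ T b = some d) := by
  rw [switch_comm hcd, switch_eq_some_right hcd.symm]

end

section

variable {U : ℕ → ℕ → ℕ → ℕ} {N q m t : ℕ} {C : Set Box}

/-- `F` is the filling that growth diagram `U` with `q` steps determines at the level `m`: the label
of a box is the number of the step at which its value drops from above `m` to at most `m`. -/
structure IsLevel (U : ℕ → ℕ → ℕ → ℕ) (q m : ℕ) (F : Filling ℕ) : Prop where
  zero (i j : ℕ) : F (i, j) ≠ some 0
  succ (i j r : ℕ) : F (i, j) = some (r + 1) ↔ r < q ∧ m < U r i j ∧ U (r + 1) i j ≤ m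

/-- `S` is the filling after the first `t` switches of the slide that takes the level `m + 1` of the
growth diagram `U` to its level `m`. -/
structure IsSlideState (U : ℕ → ℕ → ℕ → ℕ) (q m t : ℕ) (S : Filling Label) : Prop where
  circ (i j : ℕ) : S (i, j) = some .circ ↔ U t i j = m + 1
  zero (i j : ℕ) : S (i, j) ≠ some (.num 0)
  done (i j r : ℕ) (h : r < t) :
    S (i, j) = some (.num (r + 1)) ↔ r < q ∧ m < U r i j ∧ U (r + 1) i j ≤ m
  todo (i j r : ℕ) (h : t ≤ r) :
    S (i, j) = some (.num (r + 1)) ↔ r < q ∧ m + 1 < U r i j ∧ U (r + 1) i j ≤ m + 1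

theorem IsLevel.unique {F G : Filling ℕ} (hF : IsLevel U q m F) (hG : IsLevel U q m G) :
    F = G := by
  funext ⟨i, j⟩
  refine Option.ext fun x => ?_
  rcases x with _ | r
  · exact iff_of_false (hF.zero i j) (hG.zero i j)
  · rw [hF.succ, hG.succ]

theorem IsLevel.of_le_iff {F : Filling ℕ} {B : ℕ → ℕ → Prop} (h0 : ∀ i j, F (i, j) ≠ some 0)
    (hq : ∀ i j v, F (i, j) = some v → v ≤ q) (hB : ∀ i j, B i j → F (i, j) = none)
    (h : ∀ t ≤ q, ∀ i j, U t i j ≤ m ↔ B i j ∨ ∃ v ≤ t, F (i, j) = some v) : IsLevel U q m F where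
  zero := h0
  succ i j r := by
    by_cases hr : r < q
    · rw [← not_le (a := U r i j), h r hr.le, h (r + 1) hr]
      cases hF : F (i, j) with
      | none => simp
      | some u =>
        have : ¬ B i j := fun hb => Option.some_ne_none u (hF.symm.trans (hB i j hb))
        simp only [Option.some.injEq, this, false_or, exists_eq_right', hr, true_and]
        omega
    · refine iff_of_false (fun hF => ?_) fun hF => hr hF.1
      exact hr (Nat.lt_of_succ_le (hq i j _ hF))

theorem IsSlideState.switch {S : Filling Label} (h : IsSlideState U q m t S) (ht : t < q)
    (hm : m < N) (hU : SlideStep (N + 1) (U t) (U (t + 1)))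
    (hI : IsIncreasingArray (N + 1) (U t)) :
    IsSlideState U q m (t + 1) (switch (.num (t + 1)) .circ S) := by
  have hnum (b : Box) : S b = some (.num (t + 1)) ↔
      m + 1 < U t b.1 b.2 ∧ U (t + 1) b.1 b.2 ≤ m + 1 :=
    (h.todo b.1 b.2 t le_rfl).trans (and_iff_right ht)
  have hcirc (b : Box) : S b = some .circ ↔ U t b.1 b.2 = m + 1 := h.circ b.1 b.2
  refine ⟨fun i j => ?_, fun i j => ?_, fun i j r hr => ?_, fun i j r hr => ?_⟩
  · rw [switch_eq_some_right (by simp), hU.eq_iff_switch hI m.succ_pos (by omega)]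
    simp only [hnum, hcirc]
  · rw [Ne, switch_eq_some_of_ne (by simp) (by simp)]
    exact h.zero i j
  · rcases Nat.lt_succ_iff_lt_or_eq.1 hr with hr | rfl
    · rw [switch_eq_some_of_ne (by simp; omega) (by simp)]
      exact h.done i j r hr
    · rw [switch_eq_some_left (by simp), and_iff_right ht, ← Nat.add_one_le_iff,
        ← Nat.lt_add_one_iff (m := U (r + 1) i j), hU.lt_le_iff_switch hI m.succ_pos (by omega)]
      simp only [hnum, hcirc]
  · rw [switch_eq_some_of_ne (by simp; omega) (by simp)]
    exact h.todo i j r (by omega)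

theorem IsSlideState.foldl {S : Filling Label} (h : IsSlideState U q m 0 S) (hm : m < N)
    (hU : ∀ t < q, SlideStep (N + 1) (U t) (U (t + 1)))
    (hI : ∀ t ≤ q, IsIncreasingArray (N + 1) (U t)) (ht : t ≤ q) :
    IsSlideState U q m t
      ((List.range' 1 t).foldl (fun S r => ShiftedHecke.switch (.num r) .circ S) S) := by
  induction t with
  | zero => exact h
  | succ t ih =>
    rw [List.range'_1_concat, List.foldl_append, List.foldl_cons, List.foldl_nil, add_comm 1 t]
    exact (ih (by omega)).switch ht hm (hU t ht) (hI t (by omega))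

theorem addCirc_eq_circ (C : Set Box) (F : Filling ℕ) (b : Box) :
    addCirc C F b = some .circ ↔ b ∈ C := by
  unfold addCirc
  split_ifs with hb <;> simp [hb]

theorem addCirc_eq_num (C : Set Box) (F : Filling ℕ) (b : Box) (n : ℕ) :
    addCirc C F b = some (.num n) ↔ b ∉ C ∧ F b = some n := by
  unfold addCirc
  split_ifs with hb <;> simp [hb]

theorem eraseCirc_eq_some (S : Filling Label) (b : Box) (n : ℕ) :
    eraseCirc S b = some n ↔ S b = some (.num n) := by
  unfold eraseCirc
  rcases S b with _ | _ | k <;> simp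

theorem IsLevel.isSlideState {F : Filling ℕ} (h : IsLevel U q (m + 1) F)
    (hC : ∀ b : Box, b ∈ C ↔ U 0 b.1 b.2 = m + 1)
    (hU : ∀ t < q, SlideStep (N + 1) (U t) (U (t + 1))) :
    IsSlideState U q m 0 (addCirc C F) := by
  have hanti (i j r : ℕ) (hr : r ≤ q) : U r i j ≤ U 0 i j := by
    induction r with
    | zero => exact le_rfl
    | succ r ih => exact ((hU r hr).le i j).trans (ih (by omega))
  refine ⟨fun i j => ?_, fun i j => ?_, fun i j r hr => absurd hr r.not_lt_zero, fun i j r _ => ?_⟩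
  · rw [addCirc_eq_circ, hC]
  · rw [Ne, addCirc_eq_num]
    exact fun h0 => h.zero i j h0.2
  · rw [addCirc_eq_num, hC, h.succ]
    refine and_iff_right_of_imp fun hr => ?_
    have := hanti i j r hr.1.le
    simp only
    omega

theorem IsLevel.kjdt {F : Filling ℕ} (h : IsLevel U q (m + 1) F) (hm : m < N)
    (hC : ∀ b : Box, b ∈ C ↔ U 0 b.1 b.2 = m + 1)
    (hU : ∀ t < q, SlideStep (N + 1) (U t) (U (t + 1)))
    (hI : ∀ t ≤ q, IsIncreasingArray (N + 1) (U t)) :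
    IsLevel U q m (kjdt 1 q C F) := by
  have hS := (h.isSlideState hC hU).foldl hm hU hI le_rfl
  unfold ShiftedHecke.kjdt
  rw [Nat.add_sub_cancel]
  refine ⟨fun i j => ?_, fun i j r => ?_⟩
  · rw [Ne, eraseCirc_eq_some]
    exact hS.zero i j
  · rw [eraseCirc_eq_some]
    by_cases hr : r < q
    · exact hS.done i j r hr
    · simp only [hS.todo i j r (by omega), hr, false_and]

theorem IsLevel.foldl_kjdt {F : Filling ℕ} {C : ℕ → Set Box}
    (hm : m ≤ N) (h : IsLevel U q m F)
    (hC : ∀ m < N, ∀ b : Box, b ∈ C (m + 1) ↔ U 0 b.1 b.2 = m + 1)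
    (hU : ∀ t < q, SlideStep (N + 1) (U t) (U (t + 1)))
    (hI : ∀ t ≤ q, IsIncreasingArray (N + 1) (U t)) :
    IsLevel U q 0
      ((List.range' 1 m).reverse.foldl (fun S k => ShiftedHecke.kjdt 1 q (C k) S) F) := by
  induction m generalizing F with
  | zero => exact h
  | succ m ih =>
    rw [List.range'_1_concat, List.reverse_append, List.reverse_singleton, List.singleton_append,
      List.foldl_cons, add_comm 1 m]
    exact ih (by omega) (h.kjdt hm (hC m hm) hU hI)

end

/-! ### Increasing shifted tableaux -/

theorem exists_isShape {D : ℕ → ℕ → Prop} (hle : ∀ i j, D i j → i ≤ j)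
    (hleft : ∀ i j, i ≤ j → D i (j + 1) → D i j) (hup : ∀ i j, D (i + 1) j → D i j) {M : ℕ}
    (hM : ∀ i j, D i j → j < M) : ∃ a, IsShape a ∧ ∀ i j, D i j ↔ i ≤ j ∧ j < a i := by
  classical
  have hex (i : ℕ) : ∃ j, i ≤ j ∧ ¬ D i j :=
    ⟨max i M, le_max_left _ _, fun h => (hM i _ h).not_ge (le_max_right _ _)⟩
  have hiff (i j : ℕ) : D i j ↔ i ≤ j ∧ j < Nat.find (hex i) := by
    refine ⟨fun h => ⟨hle i j h, ?_⟩, fun h => ?_⟩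
    · by_contra! hj
      exact (Nat.find_spec (hex i)).2 (Nat.decreasingInduction'
        (fun k _ hk => hleft i k ((Nat.find_spec (hex i)).1.trans hk)) hj h)
    · by_contra hD
      exact Nat.find_min (hex i) h.2 ⟨h.1, hD⟩
  refine ⟨fun i => Nat.find (hex i), ⟨fun i => (Nat.find_spec (hex i)).1, fun i => ?_⟩, hiff⟩
  generalize he : Nat.find (hex (i + 1)) = e
  by_contra! hlt
  have hD := (hiff (i + 1) (e - 1)).2 (by omega)
  have := (hiff i (e - 1)).1 (hup i _ hD)
  omega

theorem IsStrictPartition.getD_succ {l : List ℕ} (hl : IsStrictPartition l) (i : ℕ) :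
    l.getD (i + 1) 0 < l.getD i 0 ∨ l.getD (i + 1) 0 = 0 := by
  by_cases h : i + 1 < l.length
  · left
    have := List.pairwise_iff_getElem.1 hl.1 i (i + 1) (by omega) h (by omega)
    simpa [List.getD, h, show i < l.length by omega] using this
  · right
    simp [List.getD, h]

theorem IsShape.exists_isStrictPartition {a : ℕ → ℕ} (ha : IsShape a) {M : ℕ} (hM : a M = M) :
    ∃ l, IsStrictPartition l ∧ ∀ i, l.getD i 0 = a i - i := by
  classical
  have hex : ∃ k, a k = k := ⟨M, hM⟩
  have hpos {i : ℕ} (hi : i < Nat.find hex) : i < a i :=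
    (ha.le i).lt_of_ne' (Nat.find_min hex hi)
  refine ⟨(List.range (Nat.find hex)).map fun i => a i - i, ⟨?_, ?_⟩, fun i => ?_⟩
  · rw [List.pairwise_map]
    refine List.Pairwise.imp_of_mem (fun {i j} hi hj hij => ?_) List.pairwise_lt_range
    have := hpos (List.mem_range.1 hi)
    have := hpos (List.mem_range.1 hj)
    have := ha.anti hij.le
    omega
  · simp only [List.mem_map, List.mem_range]
    rintro _ ⟨i, hi, rfl⟩
    exact Nat.sub_pos_of_lt (hpos hi)
  · rcases lt_or_ge i (Nat.find hex) with hi | hi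
    · simp [List.getD, hi]
    · have := ha.anti hi
      have := Nat.find_spec hex
      have := ha.le i
      have hlen : ((List.range (Nat.find hex)).map fun i => a i - i).length ≤ i := by simpa using hi
      rw [List.getD_eq_default _ _ hlen]
      omega

/-- The local form of `IsIncreasingTableau`: the conditions only involve neighbouring boxes. -/
structure IsLocallyIncreasing (T : Filling ℕ) : Prop where
  le {i j v : ℕ} (h : T (i, j) = some v) : i ≤ j
  pos {i j v : ℕ} (h : T (i, j) = some v) : 0 < v
  left {i j v : ℕ} (h : T (i, j + 1) = some v) (hij : i ≤ j) : ∃ u < v, T (i, j) = some u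
  up {i j v : ℕ} (h : T (i + 1, j) = some v) : ∃ u < v, T (i, j) = some u
  bounded : ∃ M, ∀ i j v, T (i, j) = some v → j < M

section

variable {T : Filling ℕ} {r y i j : ℕ} {a b : ℕ → ℕ}

theorem IsLocallyIncreasing.left_lt (hT : IsLocallyIncreasing T) {j' v : ℕ}
    (h : T (i, j') = some v) (hij : i ≤ j) (hj : j < j') : ∃ u < v, T (i, j) = some u := by
  induction j', hj using Nat.le_induction generalizing v with
  | base => exact hT.left h hij
  | succ k hk ih =>
    obtain ⟨u, huv, hu⟩ := hT.left h (hij.trans (Nat.le_of_lt hk))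
    obtain ⟨w, hwu, hw⟩ := ih hu
    exact ⟨w, hwu.trans huv, hw⟩

theorem IsLocallyIncreasing.up_lt (hT : IsLocallyIncreasing T) {i' v : ℕ}
    (h : T (i', j) = some v) (hi : i < i') : ∃ u < v, T (i, j) = some u := by
  induction i', hi using Nat.le_induction generalizing v with
  | base => exact hT.up h
  | succ k _ ih =>
    obtain ⟨u, huv, hu⟩ := hT.up h
    obtain ⟨w, hwu, hw⟩ := ih hu
    exact ⟨w, hwu.trans huv, hw⟩

theorem IsIncreasingTableau.isLocallyIncreasing (hT : IsIncreasingTableau T) :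
    IsLocallyIncreasing T := by
  obtain ⟨l, hl, hsome, hpos, hrow, hcol⟩ := hT
  have hmem {i j v : ℕ} (h : T (i, j) = some v) : i ≤ j ∧ j < i + l.getD i 0 :=
    (hsome (i, j)).1 (by rw [h]; rfl)
  have hex {i j : ℕ} (h : i ≤ j ∧ j < i + l.getD i 0) : ∃ u, T (i, j) = some u :=
    Option.isSome_iff_exists.1 ((hsome (i, j)).2 h)
  refine ⟨fun h => (hmem h).1, fun h => hpos _ _ h, fun {i j v} h hij => ?_, fun {i j v} h => ?_,
    l.length + l.sum, fun i j v h => ?_⟩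
  · have := hmem h
    obtain ⟨u, hu⟩ := hex (i := i) (j := j) (by omega)
    exact ⟨u, hrow _ _ _ _ _ (by omega) hu h, hu⟩
  · have := hmem h
    have := hl.getD_succ i
    obtain ⟨u, hu⟩ := hex (i := i) (j := j) (by omega)
    exact ⟨u, hcol _ _ _ _ _ (by omega) hu h, hu⟩
  · have := hmem h
    rcases lt_or_ge i l.length with hi | hi
    · have : l.getD i 0 ≤ l.sum :=
        List.getD_eq_getElem _ 0 hi ▸ List.single_le_sum (by simp) _ (List.getElem_mem hi)
      omega
    · have := List.getD_eq_default _ 0 hi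
      omega

theorem IsLocallyIncreasing.isIncreasingTableau (hT : IsLocallyIncreasing T) :
    IsIncreasingTableau T := by
  obtain ⟨M, hM⟩ := hT.bounded
  obtain ⟨a, hshape, ha⟩ := exists_isShape (D := fun i j => ∃ v, T (i, j) = some v)
    (fun i j ⟨v, h⟩ => hT.le h) (fun i j hij ⟨v, h⟩ => (hT.left h hij).imp fun _ => And.right)
    (fun i j ⟨v, h⟩ => (hT.up h).imp fun _ => And.right) (fun i j ⟨v, h⟩ => hM i j v h)
  have haM : a M = M := by
    refine (hshape.le M).antisymm' (not_lt.1 fun hlt => ?_)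
    obtain ⟨v, h⟩ := (ha M M).2 ⟨le_rfl, hlt⟩
    exact (hM _ _ _ h).false
  obtain ⟨l, hl, hget⟩ := hshape.exists_isStrictPartition haM
  refine ⟨l, hl, fun ⟨i, j⟩ => ?_, fun b x h => hT.pos (i := b.1) (j := b.2) h, ?_, ?_⟩
  · have := hshape.le i
    simp only [Option.isSome_iff_exists, ha, shiftedShape, Set.mem_ofPred_eq, hget]
    omega
  · intro i j j' x y hj hx hy
    obtain ⟨u, hu, h⟩ := hT.left_lt hy (hT.le hx) hj
    exact Option.some.inj (hx.symm.trans h) ▸ hu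
  · intro i i' j x y hi hx hy
    obtain ⟨u, hu, h⟩ := hT.up_lt hy hi
    exact Option.some.inj (hx.symm.trans h) ▸ hu

theorem isIncreasingTableau_iff : IsIncreasingTableau T ↔ IsLocallyIncreasing T :=
  ⟨fun h => h.isLocallyIncreasing, fun h => h.isIncreasingTableau⟩

/-- The boxes of `T` with labels at most `r` form the shape with row ends `a`. -/
structure HasEnds (T : Filling ℕ) (r : ℕ) (a : ℕ → ℕ) : Prop where
  shape : IsShape a
  iff (i j : ℕ) : (∃ v ≤ r, T (i, j) = some v) ↔ i ≤ j ∧ j < a i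

theorem IsLocallyIncreasing.exists_hasEnds (hT : IsLocallyIncreasing T) (r : ℕ) :
    ∃ a, HasEnds T r a := by
  obtain ⟨M, hM⟩ := hT.bounded
  have hle {i j v : ℕ} (hv : v ≤ r) (h : ∃ u < v, T (i, j) = some u) :
      ∃ u ≤ r, T (i, j) = some u :=
    h.imp fun _ hu => ⟨hu.1.le.trans hv, hu.2⟩
  obtain ⟨a, hshape, ha⟩ := exists_isShape (D := fun i j => ∃ v ≤ r, T (i, j) = some v)
    (fun i j ⟨v, _, h⟩ => hT.le h) (fun i j hij ⟨v, hv, h⟩ => hle hv (hT.left h hij))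
    (fun i j ⟨v, hv, h⟩ => hle hv (hT.up h)) (fun i j ⟨v, _, h⟩ => hM i j v h)
  exact ⟨a, hshape, ha⟩

theorem HasEnds.eq_succ_iff (ha : HasEnds T r a) (hb : HasEnds T (r + 1) b) (i j : ℕ) :
    T (i, j) = some (r + 1) ↔ i ≤ j ∧ a i ≤ j ∧ j < b i := by
  constructor
  · intro h
    obtain ⟨hij, hj⟩ := (hb.iff i j).1 ⟨_, le_rfl, h⟩
    refine ⟨hij, not_lt.1 fun hlt => ?_, hj⟩
    obtain ⟨v, hv, h'⟩ := (ha.iff i j).2 ⟨hij, hlt⟩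
    rw [h, Option.some.injEq] at h'
    omega
  · rintro ⟨hij, haj, hj⟩
    obtain ⟨v, hv, h⟩ := (hb.iff i j).2 ⟨hij, hj⟩
    rcases hv.lt_or_eq with hlt | rfl
    · have := (ha.iff i j).1 ⟨v, Nat.le_of_lt_succ hlt, h⟩
      omega
    · exact h

theorem HasEnds.rookStrip (hT : IsLocallyIncreasing T) (ha : HasEnds T r a)
    (hb : HasEnds T (r + 1) b) : RookStrip a b where
  le i := by
    by_contra! hlt
    obtain ⟨v, hv, h⟩ := (ha.iff i (b i)).2 ⟨hb.shape.le i, hlt⟩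
    exact (((hb.iff i (b i)).1 ⟨v, hv.trans r.le_succ, h⟩).2).false
  le_succ i := by
    by_contra! hlt
    have hle := ha.shape.le i
    obtain ⟨u, hu, h⟩ := hT.left ((ha.eq_succ_iff hb i (a i + 1)).2 (by omega)) hle
    exact ((ha.iff i (a i)).1 ⟨u, Nat.le_of_lt_succ hu, h⟩).2.false
  succ i := by
    by_contra! hlt
    have hle := ha.shape.le (i + 1)
    obtain ⟨u, hu, h⟩ := hT.up ((ha.eq_succ_iff hb (i + 1) (b (i + 1) - 1)).2 (by omega))
    have := (ha.iff i (b (i + 1) - 1)).1 ⟨u, Nat.le_of_lt_succ hu, h⟩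
    omega

/-- The neighbours of `(i, j)` to the left and above, as far as they belong to the shifted quarter
plane, have labels less than `y`. -/
structure Fits (T : Filling ℕ) (y i j : ℕ) : Prop where
  left {k : ℕ} (hj : j = k + 1) (hik : i ≤ k) : ∃ u < y, T (i, k) = some u
  up {k : ℕ} (hi : i = k + 1) : ∃ u < y, T (k, j) = some u

theorem Filling.set_apply {α : Type} (T : Filling α) (b c : Box) (x : α) [Decidable (c = b)] :
    T.set b x c = if c = b then some x else T c := by
  rw [Filling.set, Function.update_apply]
  congr

theorem fits_of_isLocallyIncreasing_set (h : IsLocallyIncreasing (T.set (i, j) y)) :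
    Fits T y i j := by
  have hself : T.set (i, j) y (i, j) = some y := by rw [Filling.set_apply, if_pos rfl]
  constructor
  · rintro k rfl hik
    obtain ⟨u, hu, hk⟩ := h.left hself hik
    rw [Filling.set_apply, if_neg (by simp)] at hk
    exact ⟨u, hu, hk⟩
  · rintro k rfl
    obtain ⟨u, hu, hk⟩ := h.up hself
    rw [Filling.set_apply, if_neg (by simp)] at hk
    exact ⟨u, hu, hk⟩

theorem Filling.set_eq_some {T : Filling ℕ} {b c : Box} {x v : ℕ} :
    T.set b x c = some v ↔ c = b ∧ x = v ∨ c ≠ b ∧ T c = some v := by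
  classical
  rw [Filling.set_apply]
  split_ifs with h <;> simp [h]

theorem Fits.isLocallyIncreasing_set (hT : IsLocallyIncreasing T) (hij : i ≤ j) (hy : 0 < y)
    (hlt : ∀ v, T (i, j) = some v → y < v) (h : Fits T y i j) :
    IsLocallyIncreasing (T.set (i, j) y) := by
  have hset {c : Box} {v : ℕ} (hc : ∃ u < v, T c = some u) :
      ∃ u < v, T.set (i, j) y c = some u := by
    obtain ⟨u, huv, hu⟩ := hc
    by_cases hcb : c = (i, j)
    · exact ⟨y, (hlt u (hcb ▸ hu)).trans huv, Filling.set_eq_some.2 (.inl ⟨hcb, rfl⟩)⟩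
    · exact ⟨u, huv, Filling.set_eq_some.2 (.inr ⟨hcb, hu⟩)⟩
  refine ⟨fun {i' j' v} hv => ?_, fun {i' j' v} hv => ?_, fun {i' j' v} hv hij' => ?_,
    fun {i' j' v} hv => ?_, ?_⟩
  · rcases Filling.set_eq_some.1 hv with ⟨hb, -⟩ | ⟨-, hv⟩
    · obtain ⟨rfl, rfl⟩ := Prod.mk.inj hb
      exact hij
    · exact hT.le hv
  · rcases Filling.set_eq_some.1 hv with ⟨-, rfl⟩ | ⟨-, hv⟩
    · exact hy
    · exact hT.pos hv
  · rcases Filling.set_eq_some.1 hv with ⟨hb, rfl⟩ | ⟨-, hv⟩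
    · obtain ⟨rfl, rfl⟩ := Prod.mk.inj hb
      exact hset (h.left rfl hij')
    · exact hset (hT.left hv hij')
  · rcases Filling.set_eq_some.1 hv with ⟨hb, rfl⟩ | ⟨-, hv⟩
    · obtain ⟨rfl, rfl⟩ := Prod.mk.inj hb
      exact hset (h.up rfl)
    · exact hset (hT.up hv)
  · obtain ⟨M, hM⟩ := hT.bounded
    refine ⟨max M (j + 1), fun i' j' v hv => ?_⟩
    rcases Filling.set_eq_some.1 hv with ⟨hb, -⟩ | ⟨-, hv⟩
    · obtain ⟨rfl, rfl⟩ := Prod.mk.inj hb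
      exact lt_max_of_lt_right j'.lt_succ_self
    · exact lt_max_of_lt_left (hM _ _ _ hv)

theorem IsLocallyIncreasing.set_iff (hT : IsLocallyIncreasing T) (hij : i ≤ j) (hy : 0 < y)
    (hlt : ∀ v, T (i, j) = some v → y < v) :
    IsLocallyIncreasing (T.set (i, j) y) ↔ Fits T y i j :=
  ⟨fits_of_isLocallyIncreasing_set, Fits.isLocallyIncreasing_set hT hij hy hlt⟩

end

/-! ### The insertion of a letter, label by label -/

/-- The moment of an insertion into a tableau `T` when the letter `y` is about to be inserted into
the line `L`, seen from the labels at most `r`, which form the shape with row ends `a`: so far only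
labels at most `r` have been changed, resulting in the tableau `S`, and no label at most `r` of the
line is larger than `y`. -/
structure InsertionState (T : Filling ℕ) (a : ℕ → ℕ) (r : ℕ) (L : Line) (y : ℕ) (S : Filling ℕ) :
    Prop where
  isLocallyIncreasing : IsLocallyIncreasing S
  high {e : Box} {v : ℕ} (hv : r < v) : S e = some v ↔ T e = some v
  ends : HasEnds S r a
  pos : 0 < y
  le : y ≤ r
  line {e : Box} {v : ℕ} (he : L.Contains e) (h : S e = some v) (hv : v ≤ r) : v ≤ y
  row {p : ℕ} (hL : L = .row p) (i : ℕ) (hi : i < p) : p + 1 ≤ a i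
  top {s : ℕ} (hL : L = .col s) : ∃ j u, s = j + 1 ∧ u < y ∧ S (0, j) = some u
  diag {s : ℕ} (hL : L = .col s) (i : ℕ) (hi : s ≤ i) : a i = i

open Classical in
/-- The filling `S` after `y` has taken its place, if it fits there, in the first box of the line
`L` outside the shape with row ends `a`. -/
noncomputable def placed (a : ℕ → ℕ) (L : Line) (y : ℕ) (S : Filling ℕ) : Filling ℕ := fun e =>
  if e.2 = a e.1 ∧ L.Contains e ∧ Fits S y e.1 e.2 then some y else S e

open Classical in
/-- The row ends of the shape with row ends `a` after `y` has taken its place in the line `L`. -/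
noncomputable def placedEnd (a : ℕ → ℕ) (L : Line) (y : ℕ) (S : Filling ℕ) (i : ℕ) : ℕ :=
  if L.Contains (i, a i) ∧ Fits S y i (a i) then a i + 1 else a i

/-- `e` is the first box of the line outside the shape with row ends `a`. -/
structure Line.IsFirst (a : ℕ → ℕ) (L : Line) (e : Box) : Prop where
  contains : L.Contains e
  le : e.1 ≤ e.2
  end_le : a e.1 ≤ e.2
  lt_end {b : Box} (hb : L.Contains b) (hlt : b.1 < e.1 ∨ b.2 < e.2) : b.2 < a b.1

/-- The rows of the growth diagram while a letter is inserted into the line. -/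
def lineLabel (N : ℕ) (a K : ℕ → ℕ) : Line → ℕ → ℕ → ℕ
  | .row p => rowLabel N a K p
  | .col s => colLabel N a K s

section

variable {T S P : Filling ℕ} {a b : ℕ → ℕ} {r y i j : ℕ} {L : Line} {e f : Box}

theorem RookStrip.eq_of_lt (ha : IsShape a) (hb : IsShape b) (h : RookStrip a b) {k : ℕ}
    (hk : a k = k) (hi : k < i) : b i = i := by
  obtain ⟨i, rfl⟩ : ∃ i', i = i' + 1 := ⟨i - 1, by omega⟩
  have := hb.le (i + 1)
  have := h.dichotomy ha hb i
  have := ha.anti (show k ≤ i by omega)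
  omega

theorem Fits.le_end (hv : Fits S y i j) (h : HasEnds S r a) (hy : y ≤ r + 1) (hij : i < j) :
    j ≤ a i := by
  obtain ⟨j, rfl⟩ : ∃ j', j = j' + 1 := ⟨j - 1, by omega⟩
  obtain ⟨u, hu, hS⟩ := hv.left rfl (Nat.lt_succ_iff.1 hij)
  exact ((h.iff i j).1 ⟨u, by omega, hS⟩).2

theorem Fits.lt_end (hv : Fits S y (i + 1) j) (h : HasEnds S r a) (hy : y ≤ r + 1) :
    j < a i := by
  obtain ⟨u, hu, hS⟩ := hv.up rfl
  exact ((h.iff i j).1 ⟨u, by omega, hS⟩).2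

theorem HasEnds.fits_succ_iff (h : HasEnds S r a) (hij : i ≤ j) :
    Fits S (r + 1) i j ↔ (i < j → j ≤ a i) ∧ ∀ i', i = i' + 1 → j < a i' := by
  have hlt {i j : ℕ} (hij : i ≤ j) (hj : j < a i) : ∃ u < r + 1, S (i, j) = some u := by
    simpa only [Nat.lt_succ_iff] using (h.iff i j).2 ⟨hij, hj⟩
  constructor
  · intro hv
    refine ⟨hv.le_end h le_rfl, ?_⟩
    rintro i' rfl
    exact hv.lt_end h le_rfl
  · rintro ⟨hleft, hup⟩
    exact ⟨fun hj hik => hlt hik (by omega), fun hi => hlt (by omega) (hup _ hi)⟩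

theorem Line.IsFirst.eq_of_fits (he : L.IsFirst a e) (h : HasEnds S r a) (hy : y ≤ r)
    (hL : L.Contains (i, a i)) (hv : Fits S y i (a i)) : (i, a i) = e := by
  obtain ⟨e1, e2⟩ := e
  have hi := h.shape.le i
  have hend : a e1 ≤ e2 := he.end_le
  have hlt : i < e1 ∨ a i < e2 → a i < a i := he.lt_end hL
  have hle : i ≤ e1 := by
    by_contra! hlt
    obtain ⟨i, rfl⟩ : ∃ i', i = i' + 1 := ⟨i - 1, by omega⟩
    have := hv.lt_end h (by omega)
    have := h.shape.anti (show e1 ≤ i by omega)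
    rcases L with p | s
    · exact hlt.ne' (hL.trans he.contains.symm)
    · have := hL.trans he.contains.symm
      simp only at this
      omega
  rcases L with p | s
  · obtain rfl : i = e1 := hL.trans he.contains.symm
    simp only [Prod.mk.injEq, true_and]
    omega
  · obtain rfl : a i = e2 := hL.trans he.contains.symm
    simp only [Prod.mk.injEq, and_true]
    omega

theorem Line.IsFirst.eq_end (he : L.IsFirst a e) (h : HasEnds S r a) (hy : y ≤ r)
    (hv : Fits S y e.1 e.2) : e.2 = a e.1 := by
  refine he.end_le.antisymm' ?_
  rcases he.le.eq_or_lt with heq | hlt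
  · exact heq ▸ h.shape.le e.1
  · exact hv.le_end h (by omega) hlt

theorem HasEnds.isFirst (hT : IsLocallyIncreasing T) (ha : HasEnds T r a)
    (hb : HasEnds T (r + 1) b) (hf : L.Contains f) (hTf : T f = some (r + 1)) :
    L.IsFirst a f := by
  obtain ⟨f1, f2⟩ := f
  obtain ⟨hle, hend, hlt⟩ := (ha.eq_succ_iff hb f1 f2).1 hTf
  refine ⟨hf, hle, hend, fun {e} he hef => ?_⟩
  obtain ⟨e1, e2⟩ := e
  rcases L with p | s
  · obtain rfl : e1 = f1 := he.trans hf.symm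
    have := (ha.rookStrip hT hb).le_succ e1
    simp only at hef ⊢
    omega
  · obtain rfl : e2 = f2 := he.trans hf.symm
    obtain ⟨u, hu, hS⟩ := hT.up_lt hTf (by simpa using hef)
    exact ((ha.iff e1 e2).1 ⟨u, by omega, hS⟩).2

theorem le_placedEnd (a : ℕ → ℕ) (L : Line) (y : ℕ) (S : Filling ℕ) (i : ℕ) :
    a i ≤ placedEnd a L y S i := by
  unfold placedEnd
  split_ifs <;> omega

theorem placedEnd_le (a : ℕ → ℕ) (L : Line) (y : ℕ) (S : Filling ℕ) (i : ℕ) :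
    placedEnd a L y S i ≤ a i + 1 := by
  unfold placedEnd
  split_ifs <;> omega

theorem placedEnd_eq_succ_iff :
    placedEnd a L y S i = a i + 1 ↔ L.Contains (i, a i) ∧ Fits S y i (a i) := by
  unfold placedEnd
  split_ifs with h <;> simpa using h

theorem HasEnds.eq_of_forall_ne (hT : IsLocallyIncreasing T) (ha : HasEnds T r a)
    (hb : HasEnds T (r + 1) b) (hL : ∀ e, L.Contains e → T e ≠ some (r + 1))
    (hi : L.Contains (i, a i)) : b i = a i := by
  by_contra hne
  have := (ha.rookStrip hT hb).le i
  have := ha.shape.le i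
  exact hL _ hi ((ha.eq_succ_iff hb i (a i)).2 (by omega))

theorem Line.next_eq_row {p : ℕ} (hf : L.Contains f) (h : L.next f = .row p) :
    p = f.1 + 1 ∧ f.1 ≠ f.2 := by
  rcases L with p' | s
  · obtain rfl : f.1 = p' := hf
    simp only [next] at h
    split_ifs at h with hd
    exact ⟨(Line.row.inj h).symm, hd⟩
  · cases h

theorem Line.next_eq_col {s : ℕ} (hf : L.Contains f) (h : L.next f = .col s) :
    s = f.2 + 1 ∧ (L = .row f.1 ∧ f.1 = f.2 ∨ L = .col f.2) := by
  rcases L with p | s'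
  · obtain rfl : f.1 = p := hf
    simp only [next] at h
    split_ifs at h with hd
    exact ⟨(Line.col.inj h).symm, .inl ⟨rfl, hd⟩⟩
  · obtain rfl : f.2 = s' := hf
    exact ⟨(Line.col.inj h).symm, .inr rfl⟩

namespace InsertionState

theorem exists_isFirst (h : InsertionState T a r L y S) : ∃ e, L.IsFirst a e := by
  classical
  rcases L with p | s
  · refine ⟨(p, a p), rfl, h.ends.shape.le p, le_rfl, fun {e} he hlt => ?_⟩
    obtain ⟨e1, e2⟩ := e
    obtain rfl : e1 = p := he
    simpa using hlt
  · have hs : a s ≤ s := (h.diag rfl s le_rfl).le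
    have hex : ∃ i, a i ≤ s := ⟨s, hs⟩
    refine ⟨(Nat.find hex, s), rfl, Nat.find_min' hex hs, Nat.find_spec hex, fun {e} he hlt => ?_⟩
    obtain ⟨e1, e2⟩ := e
    obtain rfl : e2 = s := he
    exact not_le.1 (Nat.find_min hex (hlt.resolve_right (lt_irrefl _)))

open Classical in
theorem placed_eq (h : InsertionState T a r L y S) (he : L.IsFirst a e) :
    placed a L y S = if IsIncreasingTableau (S.set e y) then S.set e y else S := by
  have hiff : IsIncreasingTableau (S.set e y) ↔ Fits S y e.1 e.2 := by
    rw [isIncreasingTableau_iff]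
    refine h.isLocallyIncreasing.set_iff he.le h.pos fun v hv => ?_
    by_contra! hvy
    exact ((h.ends.iff e.1 e.2).1 ⟨v, hvy.trans h.le, hv⟩).2.not_ge he.end_le
  funext c
  simp only [hiff, placed]
  by_cases hc : c.2 = a c.1 ∧ L.Contains c ∧ Fits S y c.1 c.2
  · obtain rfl : c = e := by
      obtain ⟨c1, c2⟩ := c
      obtain ⟨hend, hc, hv⟩ := hc
      obtain rfl : c2 = a c1 := hend
      exact he.eq_of_fits h.ends h.le hc hv
    rw [if_pos hc, if_pos hc.2.2, Filling.set_apply, if_pos rfl]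
  · rw [if_neg hc]
    split_ifs with hv
    · rw [Filling.set_apply, if_neg]
      rintro rfl
      exact hc ⟨he.eq_end h.ends h.le hv, he.contains, hv⟩
    · rfl

theorem isLocallyIncreasing_placed (h : InsertionState T a r L y S) :
    IsLocallyIncreasing (placed a L y S) := by
  classical
  obtain ⟨e, he⟩ := h.exists_isFirst
  rw [h.placed_eq he]
  split_ifs with hi
  · exact hi.isLocallyIncreasing
  · exact h.isLocallyIncreasing

theorem placed_iff (h : InsertionState T a r L y S) (i j : ℕ) :
    (∃ u ≤ r, placed a L y S (i, j) = some u) ↔ i ≤ j ∧ j < placedEnd a L y S i := by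
  have hS := h.ends.iff i j
  have hle := h.ends.shape.le i
  unfold placed placedEnd
  by_cases hj : j = a i
  · subst hj
    by_cases hc : L.Contains (i, a i) ∧ Fits S y i (a i)
    · rw [if_pos ⟨rfl, hc⟩, if_pos hc]
      exact iff_of_true ⟨y, h.le, rfl⟩ ⟨hle, (a i).lt_add_one⟩
    · rw [if_neg fun hc' => hc hc'.2, if_neg hc]
      exact hS
  · rw [if_neg fun hc => hj hc.1, hS]
    split_ifs <;> omega

theorem hasEnds_placed (h : InsertionState T a r L y S) :
    HasEnds (placed a L y S) r (placedEnd a L y S) := by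
  obtain ⟨c, hc⟩ := h.isLocallyIncreasing_placed.exists_hasEnds r
  obtain rfl : c = placedEnd a L y S := by
    funext i
    have hiff (j : ℕ) := (hc.iff i j).symm.trans (h.placed_iff i j)
    have := hiff (c i)
    have := hiff (placedEnd a L y S i)
    have := hc.shape.le i
    have := h.ends.shape.le i
    have := le_placedEnd a L y S i
    omega
  exact hc

theorem placedEnd_succ_iff (h : InsertionState T a r L y S) (hb : IsShape b) {L' : Line} (i : ℕ) :
    placedEnd b L' (r + 1) (placed a L y S) i = b i + 1 ↔ L'.Contains (i, b i) ∧
      (i < b i → b i ≤ placedEnd a L y S i) ∧ ∀ i', i = i' + 1 → b i < placedEnd a L y S i' := by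
  rw [placedEnd_eq_succ_iff, h.hasEnds_placed.fits_succ_iff (hb.le i)]

theorem rowState {p : ℕ} (h : InsertionState T a r (.row p) y S) :
    RowState a (placedEnd a (.row p) y S) p where
  eq i hi := if_neg fun hc => hi hc.1
  le := le_placedEnd ..
  le_succ := placedEnd_le ..
  up i hi := by
    subst hi
    have := h.row rfl i i.lt_add_one
    have := h.ends.shape.succ i
    rcases (placedEnd_le a (.row (i + 1)) y S (i + 1)).lt_or_eq with hlt | heq
    · omega
    · have := (placedEnd_eq_succ_iff.1 heq).2.lt_end h.ends (by have := h.le; omega)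
      omega
  nondiag := h.row rfl
  zero := by
    have hle := le_placedEnd a (.row p) y S 0
    obtain rfl | hp := p.eq_zero_or_pos
    · obtain h0 | h0 := (a 0).eq_zero_or_pos
      · have := (placedEnd_eq_succ_iff (L := .row 0) (y := y) (S := S) (i := 0) (a := a)).2
          ⟨rfl, fun _ _ => by omega, fun _ => by omega⟩
        omega
      · exact h0.trans_le hle
    · have := h.row rfl 0 hp
      omega

theorem colState {s : ℕ} (h : InsertionState T a r (.col s) y S) :
    ColState a (placedEnd a (.col s) y S) s where
  diag := h.diag rfl
  eq i := by
    have := le_placedEnd a (.col s) y S i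
    rcases (placedEnd_le a (.col s) y S i).lt_or_eq with hlt | heq
    · omega
    · have : a i = s := (placedEnd_eq_succ_iff.1 heq).1
      omega
  up i := by
    have := le_placedEnd a (.col s) y S (i + 1)
    rcases (placedEnd_le a (.col s) y S (i + 1)).lt_or_eq with hlt | heq
    · omega
    · obtain ⟨hs, hv⟩ := placedEnd_eq_succ_iff.1 heq
      exact .inr (hs ▸ hv.lt_end h.ends (by have := h.le; omega))
  zero := by
    obtain ⟨j, u, rfl, hu, hS⟩ := h.top rfl
    have hj := ((h.ends.iff 0 j).1 ⟨u, hu.le.trans h.le, hS⟩).2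
    obtain h0 | h0 := (Nat.succ_le_of_lt hj).eq_or_lt
    · have hv : Fits S y 0 (a 0) :=
        ⟨fun {k} hk _ => ⟨u, hu, by rwa [show k = j by omega]⟩, fun hi => by omega⟩
      have hL : (Line.col (j + 1)).Contains (0, a 0) := h0.symm
      have := placedEnd_eq_succ_iff.2 ⟨hL, hv⟩
      omega
    · exact h0.trans_le (le_placedEnd a _ y S 0)

theorem hasEnds_succ (h : InsertionState T a r L y S) (ha : HasEnds T r a)
    (hb : HasEnds T (r + 1) b) : HasEnds S (r + 1) b := by
  refine ⟨hb.shape, fun i j => ?_⟩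
  have hiff := (h.ends.iff i j).trans (ha.iff i j).symm
  simp only [← hb.iff i j, Nat.le_add_one_iff, or_and_right, exists_or, hiff, exists_eq_left,
    h.high (lt_add_one r)]

theorem stay (h : InsertionState T a r L y S) (hT : IsLocallyIncreasing T) (ha : HasEnds T r a)
    (hb : HasEnds T (r + 1) b) (hL : ∀ e, L.Contains e → T e ≠ some (r + 1)) :
    InsertionState T b (r + 1) L y S where
  isLocallyIncreasing := h.isLocallyIncreasing
  high hv := h.high (by omega)
  ends := h.hasEnds_succ ha hb
  pos := h.pos
  le := h.le.trans r.le_succ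
  line {e v} he hS hv := by
    rcases hv.lt_or_eq with hlt | rfl
    · exact h.line he hS (Nat.lt_succ_iff.1 hlt)
    · exact absurd ((h.high (lt_add_one r)).1 hS) (hL e he)
  row hp i hi := (h.row hp i hi).trans ((ha.rookStrip hT hb).le i)
  top := h.top
  diag {s} hs i hi := by
    have hdiag := h.diag hs s le_rfl
    rcases hi.eq_or_lt with rfl | hlt
    · exact (ha.eq_of_forall_ne hT hb hL (by rw [hs, hdiag]; rfl)).trans hdiag
    · exact (ha.rookStrip hT hb).eq_of_lt ha.shape hb.shape hdiag hlt

theorem eq_end_stay_iff (h : InsertionState T a r L y S) (hT : IsLocallyIncreasing T)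
    (ha : HasEnds T r a) (hb : HasEnds T (r + 1) b)
    (hL : ∀ e, L.Contains e → T e ≠ some (r + 1)) (hc : L.Contains (i, j)) (hv : Fits S y i j) :
    j = b i ↔ j = a i := by
  constructor
  · rintro rfl
    have := (ha.rookStrip hT hb).le i
    have := ha.shape.le i
    rcases (hb.shape.le i).eq_or_lt with heq | hlt
    · omega
    · have := hv.le_end h.ends (h.le.trans r.le_succ) hlt
      omega
  · rintro rfl
    exact (ha.eq_of_forall_ne hT hb hL hc).symm

theorem placed_stay (h : InsertionState T a r L y S) (hT : IsLocallyIncreasing T)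
    (ha : HasEnds T r a) (hb : HasEnds T (r + 1) b)
    (hL : ∀ e, L.Contains e → T e ≠ some (r + 1)) : placed b L y S = placed a L y S := by
  classical
  funext ⟨i, j⟩
  exact if_congr (and_congr_left fun hc => h.eq_end_stay_iff hT ha hb hL hc.1 hc.2) rfl rfl

theorem placedEnd_stay (h : InsertionState T a r L y S) (hT : IsLocallyIncreasing T)
    (ha : HasEnds T r a) (hb : HasEnds T (r + 1) b)
    (hL : ∀ e, L.Contains e → T e ≠ some (r + 1)) (i : ℕ) :
    placedEnd b L y S i = max (placedEnd a L y S i) (b i) := by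
  have := (ha.rookStrip hT hb).le i
  have := (ha.rookStrip hT hb).le_succ i
  have key {j : ℕ} (hc : L.Contains (i, j) ∧ Fits S y i j) :=
    h.eq_end_stay_iff hT ha hb hL hc.1 hc.2
  unfold placedEnd
  split_ifs with hcb hca hca
  · have := (key hcb).1 rfl
    omega
  · exact absurd ((key hcb).1 rfl ▸ hcb) hca
  · exact absurd ((key hca).2 rfl ▸ hca) hcb
  · omega

theorem placed_eq_or (a : ℕ → ℕ) (L : Line) (y : ℕ) (S : Filling ℕ) (e : Box) :
    placed a L y S e = S e ∨ placed a L y S e = some y := by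
  unfold placed
  split_ifs
  · exact .inr rfl
  · exact .inl rfl

theorem placed_of_ne (h : InsertionState T a r L y S) (hf : L.IsFirst a f) (hef : e ≠ f) :
    placed a L y S e = S e := by
  classical
  rw [h.placed_eq hf]
  split_ifs
  · rw [Filling.set_apply, if_neg hef]
  · rfl

theorem placed_of_fits (h : InsertionState T a r L y S) (hf : L.IsFirst a f)
    (hv : Fits S y f.1 f.2) : placed a L y S f = some y :=
  if_pos ⟨hf.eq_end h.ends h.le hv, hf.contains, hv⟩

theorem row_next (ha : HasEnds T r a) (hb : HasEnds T (r + 1) b) (hf : L.Contains f)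
    (hTf : T f = some (r + 1)) {p : ℕ} (hL : L.next f = .row p) (hi : i < p) : p + 1 ≤ b i := by
  obtain ⟨f1, f2⟩ := f
  obtain ⟨rfl, hne⟩ := Line.next_eq_row hf hL
  obtain ⟨hle, -, hlt⟩ := (ha.eq_succ_iff hb f1 f2).1 hTf
  have := hb.shape.anti (Nat.lt_succ_iff.1 hi)
  simp only at hne this
  omega

theorem diag_next (h : InsertionState T a r L y S) (hT : IsLocallyIncreasing T)
    (ha : HasEnds T r a) (hb : HasEnds T (r + 1) b) (hf : L.Contains f)
    (hTf : T f = some (r + 1)) {s : ℕ} (hL : L.next f = .col s) (hi : s ≤ i) : b i = i := by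
  obtain ⟨f1, f2⟩ := f
  obtain ⟨rfl, hcase | hcase⟩ := Line.next_eq_col hf hL
  · obtain ⟨-, rfl : f1 = f2⟩ := hcase
    have hle := ((ha.eq_succ_iff hb f1 f1).1 hTf).2.1
    exact (ha.rookStrip hT hb).eq_of_lt ha.shape hb.shape (hle.antisymm (ha.shape.le f1)) hi
  · exact (ha.rookStrip hT hb).eq_of_lt ha.shape hb.shape (h.diag hcase f2 le_rfl) hi

theorem top_next (h : InsertionState T a r L y S) (hf : L.IsFirst a f)
    (hSf : S f = some (r + 1)) {s : ℕ} (hL : L.next f = .col s) :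
    ∃ j u, s = j + 1 ∧ u < r + 1 ∧ placed a L y S (0, j) = some u := by
  obtain ⟨f1, f2⟩ := f
  obtain ⟨rfl, hcase⟩ := Line.next_eq_col hf.contains hL
  obtain rfl | hf1 := f1.eq_zero_or_pos
  · refine ⟨f2, y, rfl, Nat.lt_succ_of_le h.le, h.placed_of_fits hf ⟨fun {k} hk _ => ?_,
      fun hi => absurd hi (Nat.zero_ne_add_one _)⟩⟩
    simp only at hk
    subst hk
    obtain hL | hL := hcase
    · exact absurd hL.2 (Nat.zero_ne_add_one _)
    · obtain ⟨j, u, hj, hu, hS⟩ := h.top hL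
      obtain rfl : k = j := Nat.succ_injective hj
      exact ⟨u, hu, hS⟩
  · obtain ⟨u, hu, hS⟩ := h.isLocallyIncreasing.up_lt hSf hf1
    refine ⟨f2, u, rfl, hu, ?_⟩
    rwa [h.placed_of_ne hf (by simpa using hf1.ne)]

theorem move (h : InsertionState T a r L y S) (hT : IsLocallyIncreasing T) (ha : HasEnds T r a)
    (hb : HasEnds T (r + 1) b) (hf : L.Contains f) (hTf : T f = some (r + 1)) :
    InsertionState T b (r + 1) (L.next f) (r + 1) (placed a L y S) := by
  have hle := h.le
  have hfirst := ha.isFirst hT hb hf hTf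
  have hSf := (h.high (lt_add_one r)).2 hTf
  have hplaced : placed a L y S f = some (r + 1) ∨ placed a L y S f = some y :=
    hSf ▸ placed_eq_or a L y S f
  refine ⟨h.isLocallyIncreasing_placed, fun {e v} hv => ?_, ⟨hb.shape, fun i j => ?_⟩,
    r.succ_pos, le_rfl, fun _ _ hv => hv, fun hL _ hi => row_next ha hb hf hTf hL hi,
    h.top_next hfirst hSf, fun hL _ hi => h.diag_next hT ha hb hf hTf hL hi⟩
  · by_cases hef : e = f
    · subst hef
      rw [hTf]
      rcases hplaced with hp | hp <;> rw [hp]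
      simp only [Option.some.injEq]
      omega
    · rw [h.placed_of_ne hfirst hef, h.high (by omega)]
  · rw [← (h.hasEnds_succ ha hb).iff i j]
    by_cases hef : (i, j) = f
    · rw [hef]
      refine iff_of_true ?_ ⟨_, le_rfl, hSf⟩
      rcases hplaced with hp | hp
      · exact ⟨_, le_rfl, hp⟩
      · exact ⟨_, hle.trans r.le_succ, hp⟩
    · rw [h.placed_of_ne hfirst hef]

theorem insertsTo_placed (h : InsertionState T a r L y S) (hr : ∀ e v, S e = some v → v ≤ r) :
    InsertsTo L S y (placed a L y S) := by
  obtain ⟨e, he⟩ := h.exists_isFirst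
  have hAll : L.AllLE S y := fun b v hb hv => h.line hb hv (hr b v hv)
  have hne {b : Box} (hb : b.1 ≤ b.2) (hlt : b.2 < a b.1) : S b ≠ none := by
    obtain ⟨v, -, hv⟩ := (h.ends.iff b.1 b.2).2 ⟨hb, hlt⟩
    exact Option.ne_none_iff_exists'.2 ⟨v, hv⟩
  have hEnd : L.IsEnd S e := by
    have hnone : S e = none := Option.eq_none_iff_forall_ne_some.2 fun v hv =>
      ((h.ends.iff e.1 e.2).1 ⟨v, hr _ _ hv, hv⟩).2.not_ge he.end_le
    obtain ⟨e1, e2⟩ := e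
    rcases L with p | s
    · obtain rfl : e1 = p := he.contains
      exact ⟨rfl, he.le, hnone, fun j hj hlt => hne hj (he.lt_end rfl (.inr hlt))⟩
    · obtain rfl : e2 = s := he.contains
      exact ⟨rfl, hnone, fun i hi => hne (hi.le.trans he.le) (he.lt_end rfl (.inl hi))⟩
  classical
  rw [h.placed_eq he]
  split_ifs with hi
  · exact .adjoin hAll hEnd hi
  · exact .stay hAll hEnd hi

theorem insertsTo_of_next (h : InsertionState T a r L y S) (hT : IsLocallyIncreasing T)
    (ha : HasEnds T r a) (hb : HasEnds T (r + 1) b) (hf : L.Contains f)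
    (hTf : T f = some (r + 1)) (hP : InsertsTo (L.next f) (placed a L y S) (r + 1) P) :
    InsertsTo L S y P := by
  have hbumped : L.IsBumped S y f (r + 1) :=
    ⟨hf, (h.high (lt_add_one r)).2 hTf, Nat.lt_succ_of_le h.le, fun c z hc hz hyz =>
      Nat.succ_le_of_lt (not_le.1 fun hzr => (h.line hc hz hzr).not_gt hyz)⟩
  classical
  rw [h.placed_eq (ha.isFirst hT hb hf hTf)] at hP
  split_ifs at hP with hi
  · exact .replace hbumped hi hP
  · exact .bump hbumped hi hP

theorem slideStep_stay {N : ℕ} (h : InsertionState T a r L y S) (hT : IsLocallyIncreasing T)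
    (ha : HasEnds T r a) (hb : HasEnds T (r + 1) b) (hN : b 0 < N)
    (hL : ∀ e, L.Contains e → T e ≠ some (r + 1)) :
    SlideStep (N + 1) (lineLabel N a (placedEnd a L y S) L)
      (lineLabel N b (placedEnd b L y S) L) := by
  have h' := h.stay hT ha hb hL
  have hstrip := ha.rookStrip hT hb
  have hK := h.placedEnd_stay hT ha hb hL
  have hend {i : ℕ} (hi : L.Contains (i, a i)) := ha.eq_of_forall_ne hT hb hL hi
  rcases L with p | s
  · have hp : b p = a p := hend rfl
    have hle := h.rowState.le
    exact slideStep_row_stay ha.shape hb.shape hstrip hN h.rowState h'.rowState hp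
      ((hK p).trans (max_eq_left (hp.trans_le hle)))
  · exact slideStep_col_stay ha.shape hb.shape hstrip hN h.colState h'.colState
      (fun i hi => (hend hi).trans hi) hK

theorem placedEnd_col_iff (h : InsertionState T a r L y S) (hb : IsShape b) {s : ℕ}
    (hbi : b i = s + 1) (his : i ≤ s) :
    placedEnd b (.col (s + 1)) (r + 1) (placed a L y S) i = s + 2 ↔
      s + 1 ≤ placedEnd a L y S i ∧ ∀ i', i = i' + 1 → s + 1 < placedEnd a L y S i' := by
  have hc : (Line.col (s + 1)).Contains (i, s + 1) := rfl
  simpa only [hbi, hc, Nat.lt_succ_of_le his, true_and, true_imp_iff] using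
    h.placedEnd_succ_iff hb (L' := .col (s + 1)) i

theorem slideStep_move {N : ℕ} (h : InsertionState T a r L y S) (hT : IsLocallyIncreasing T)
    (ha : HasEnds T r a) (hb : HasEnds T (r + 1) b) (hN : b 0 < N) (hf : L.Contains f)
    (hTf : T f = some (r + 1)) :
    SlideStep (N + 1) (lineLabel N a (placedEnd a L y S) L)
      (lineLabel N b (placedEnd b (L.next f) (r + 1) (placed a L y S)) (L.next f)) := by
  have h' := h.move hT ha hb hf hTf
  have hstrip := ha.rookStrip hT hb
  have hcol {s i : ℕ} := h.placedEnd_col_iff hb.shape (s := s) (i := i)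
  obtain ⟨f1, f2⟩ := f
  have hf12 := (ha.eq_succ_iff hb f1 f2).1 hTf
  have hbf := hstrip.le_succ f1
  rcases L with p | s
  · obtain rfl : f1 = p := hf
    obtain rfl | hd := eq_or_ne f1 f2
    · have haf : a f1 = f1 := by omega
      simp only [Line.next, if_true, lineLabel] at h' ⊢
      rw [rowLabel_eq_colLabel ha.shape h.rowState haf]
      exact slideStep_col_col ha.shape hb.shape hstrip hN (h.rowState.colState ha.shape haf)
        h'.colState haf (by omega) fun i => hcol
    · simp only [Line.next, if_neg hd, lineLabel] at h' ⊢
      refine slideStep_row_row ha.shape hb.shape hstrip hN h.rowState h'.rowState (by omega)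
        (by omega) ?_
      have hc : (Line.row (f1 + 1)).Contains (f1 + 1, b (f1 + 1)) := rfl
      have := ha.shape.le (f1 + 1)
      have := hb.shape.le (f1 + 1)
      simp only [h.placedEnd_succ_iff hb.shape, hc, true_and, Nat.add_right_cancel_iff,
        forall_eq', h.rowState.eq (f1 + 1) f1.succ_ne_self]
      exact and_congr_left fun _ => by omega
  · obtain rfl : f2 = s := hf
    exact slideStep_col_col (f := f1) ha.shape hb.shape hstrip hN h.colState h'.colState
      (by omega) (by omega) fun i => hcol

end InsertionState

end

/-! ### The growth diagram of an insertion -/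

section

variable {N M K S o c p s i j : ℕ} {a k : ℕ → ℕ}

theorem growthRow_eq_zero_iff (ho : K < S → 0 < o) (hM : 0 < M) :
    growthRow M K S o c j = 0 ↔ j < K := by
  have := growthRow_cases M K S o c j
  omega

theorem growthRow_le_iff (hK : K ≤ S) (ho : K < S → o ≤ N) (hS : K < S → S + c ≤ N + 1) :
    growthRow (N + 1) K S o c j ≤ N ↔ j < S := by
  have := growthRow_cases (N + 1) K S o c j
  omega

theorem IsShape.skewEnd_bounds (ha : IsShape a) (hN : a 0 < N) (M i : ℕ) :
    i = 0 ∧ skewEnd M a i = M ∨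
    0 < i ∧ a i ≤ skewEnd M a i ∧ i ≤ skewEnd M a i ∧
      (skewEnd M a i = i ∨ skewEnd M a i ≤ N) := by
  rcases i with _ | i
  · exact .inl ⟨rfl, rfl⟩
  · have := ha.succ i
    have := ha.le i
    have := ha.anti i.zero_le
    simp only [skewEnd_succ]
    omega

theorem freshLabel_eq_zero_iff : freshLabel N a i j = 0 ↔ j < a i :=
  growthRow_eq_zero_iff (fun _ => i.succ_pos) N.succ_pos

theorem IsShape.freshLabel_le_iff (ha : IsShape a) (hN : a 0 < N) :
    freshLabel N a i j ≤ N ↔ j < skewEnd N a i := by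
  have := ha.skewEnd_bounds hN N i
  have := ha.le i
  obtain rfl | hi := i.eq_zero_or_pos
  all_goals apply growthRow_le_iff <;> omega

theorem RowState.rowLabel_eq_zero_iff (hk : RowState a k p) :
    rowLabel N a k p i j = 0 ↔ j < k i := by
  refine growthRow_eq_zero_iff (fun _ => ?_) N.succ_pos
  have := hk.zero
  unfold rowCorner
  split_ifs with h
  · obtain ⟨rfl, h⟩ := h
    obtain rfl | hi := i.eq_zero_or_pos <;> omega
  · exact i.succ_pos

theorem RowState.rowLabel_le_iff (hk : RowState a k p) (ha : IsShape a) (hN : a 0 < N) :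
    rowLabel N a k p i j ≤ N ↔ j < skewEnd (N + 1) a i := by
  have := ha.skewEnd_bounds hN (N + 1) i
  have := ha.le i
  have := hk.lt_skewEnd hN
  obtain hi | rfl | hi := lt_trichotomy i p
  · have := hk.above hi
    obtain rfl | hi := i.eq_zero_or_pos
    all_goals apply growthRow_le_iff <;> omega
  · have := hk.current
    obtain rfl | hi := i.eq_zero_or_pos
    all_goals apply growthRow_le_iff <;> omega
  · have := hk.below hi
    apply growthRow_le_iff <;> omega

theorem ColState.colLabel_eq_zero_iff (hk : ColState a k s) :
    colLabel N a k s i j = 0 ↔ j < k i := by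
  refine growthRow_eq_zero_iff (fun _ => ?_) N.succ_pos
  have := hk.cases i
  have := hk.zero
  obtain rfl | hi := i.eq_zero_or_pos <;> omega

theorem ColState.colLabel_le_iff (hk : ColState a k s) (ha : IsShape a) (hN : a 0 < N) :
    colLabel N a k s i j ≤ N ↔ j < skewEnd (N + 1) a i := by
  have := ha.skewEnd_bounds hN (N + 1) i
  have := ha.le i
  have := hk.cases i
  have := hk.lt_skewEnd hN i
  obtain rfl | hi := i.eq_zero_or_pos
  all_goals apply growthRow_le_iff <;> omega

end

section

variable {T S : Filling ℕ} {a b : ℕ → ℕ} {N r v y i j : ℕ} {L : Line} {e : Box}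

namespace InsertionState

theorem lineLabel_eq_zero_iff (h : InsertionState T a r L y S) :
    lineLabel N a (placedEnd a L y S) L i j = 0 ↔
      j < i ∨ ∃ v ≤ r, placed a L y S (i, j) = some v := by
  have hzero : lineLabel N a (placedEnd a L y S) L i j = 0 ↔ j < placedEnd a L y S i := by
    rcases L with p | s
    · exact h.rowState.rowLabel_eq_zero_iff
    · exact h.colState.colLabel_eq_zero_iff
  have := h.hasEnds_placed.shape.le i
  rw [hzero, h.placed_iff]
  omega

theorem lineLabel_le_iff (h : InsertionState T a r L y S) (hN : a 0 < N) :
    lineLabel N a (placedEnd a L y S) L i j ≤ N ↔ j < skewEnd (N + 1) a i := by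
  rcases L with p | s
  · exact h.rowState.rowLabel_le_iff h.ends.shape hN
  · exact h.colState.colLabel_le_iff h.ends.shape hN

theorem placed_eq_some_iff_of_lt (h : InsertionState T a r L y S) (hv : v < y) :
    placed a L y S e = some v ↔ S e = some v := by
  constructor
  · intro hp
    obtain hS | hS := placed_eq_or a L y S e
    · exact hS ▸ hp
    · rw [hp, Option.some.injEq] at hS
      exact absurd hS hv.ne
  · intro hS
    obtain ⟨-, he⟩ := (h.ends.iff e.1 e.2).1 ⟨v, hv.le.trans h.le, hS⟩
    rw [placed, if_neg fun hc => he.ne hc.1, hS]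

theorem initial (hT : IsLocallyIncreasing T) (ha : HasEnds T r a) (hr : 0 < r) :
    InsertionState T a r (.row 0) r T where
  isLocallyIncreasing := hT
  high _ := Iff.rfl
  ends := ha
  pos := hr
  le := le_rfl
  line _ _ hv := hv
  row hp i hi := by
    cases hp
    exact absurd hi i.not_lt_zero
  top hs := by cases hs
  diag hs := by cases hs

end InsertionState

theorem slideStep_initial (hT : IsLocallyIncreasing T) (ha : HasEnds T r a)
    (hb : HasEnds T (r + 1) b) (hN : b 0 < N) :
    SlideStep (N + 1) (freshLabel N a)
      (lineLabel N b (placedEnd b (.row 0) (r + 1) T) (.row 0)) := by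
  have hstrip := ha.rookStrip hT hb
  have h := InsertionState.initial hT hb r.succ_pos
  refine slideStep_start ha.shape hb.shape hstrip hN h.rowState ?_
  have := hstrip.le 0
  have := hb.shape.le 0
  simp only [placedEnd_eq_succ_iff, ha.fits_succ_iff (b 0).zero_le, Line.Contains, true_and,
    (Nat.succ_ne_zero _).symm, IsEmpty.forall_iff, implies_true, and_true]
  omega

end

/-- A letter that is about to be inserted into a line of a tableau. -/
structure PendingInsertion where
  line : Line
  letter : ℕ
  tableau : Filling ℕ

namespace PendingInsertion

variable {T P : Filling ℕ} {a b : ℕ → ℕ} {N r v : ℕ} {e : Box} {σ : PendingInsertion}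

/-- `σ` is an insertion into `T` that has passed the labels at most `r`, which form the shape with
row ends `a`. -/
def IsAt (σ : PendingInsertion) (T : Filling ℕ) (a : ℕ → ℕ) (r : ℕ) : Prop :=
  InsertionState T a r σ.line σ.letter σ.tableau

/-- The tableau in which the pending letter has taken its place at the end of the shape with row
ends `a`. -/
noncomputable def result (σ : PendingInsertion) (a : ℕ → ℕ) : Filling ℕ :=
  placed a σ.line σ.letter σ.tableau

/-- The rows of the growth diagram at the pending insertion. -/
noncomputable def label (N : ℕ) (a : ℕ → ℕ) (σ : PendingInsertion) : ℕ → ℕ → ℕ :=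
  lineLabel N a (placedEnd a σ.line σ.letter σ.tableau) σ.line

open Classical in
/-- The insertion after the label `r + 1` of `T` has been passed: the pending letter bumps it if it
occurs in the line. -/
noncomputable def step (T : Filling ℕ) (a : ℕ → ℕ) (r : ℕ) (σ : PendingInsertion) :
    PendingInsertion :=
  if h : ∃ f, σ.line.Contains f ∧ T f = some (r + 1) then
    ⟨σ.line.next h.choose, r + 1, σ.result a⟩
  else σ

theorem step_cases (T : Filling ℕ) (a : ℕ → ℕ) (r : ℕ) (σ : PendingInsertion) :
    (∃ f, σ.line.Contains f ∧ T f = some (r + 1) ∧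
      σ.step T a r = ⟨σ.line.next f, r + 1, σ.result a⟩) ∨
    (∀ f, σ.line.Contains f → T f ≠ some (r + 1)) ∧ σ.step T a r = σ := by
  by_cases h : ∃ f, σ.line.Contains f ∧ T f = some (r + 1)
  · exact .inl ⟨h.choose, h.choose_spec.1, h.choose_spec.2, dif_pos h⟩
  · exact .inr ⟨fun f hf hTf => h ⟨f, hf, hTf⟩, dif_neg h⟩

section

variable (h : σ.IsAt T a r) (hT : IsLocallyIncreasing T) (ha : HasEnds T r a)
  (hb : HasEnds T (r + 1) b)

include h hT ha hb

theorem IsAt.step : (σ.step T a r).IsAt T b (r + 1) := by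
  obtain ⟨f, hf, hTf, heq⟩ | ⟨hL, heq⟩ := σ.step_cases T a r
  · rw [heq]
    exact InsertionState.move h hT ha hb hf hTf
  · rw [heq]
    exact InsertionState.stay h hT ha hb hL

theorem IsAt.insertsTo_of_step
    (hP : InsertsTo (σ.step T a r).line (σ.step T a r).tableau (σ.step T a r).letter P) :
    InsertsTo σ.line σ.tableau σ.letter P := by
  obtain ⟨f, hf, hTf, heq⟩ | ⟨-, heq⟩ := σ.step_cases T a r
  · rw [heq] at hP
    exact InsertionState.insertsTo_of_next h hT ha hb hf hTf hP
  · rwa [heq] at hP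

theorem IsAt.slideStep (hN : b 0 < N) :
    SlideStep (N + 1) (σ.label N a) ((σ.step T a r).label N b) := by
  obtain ⟨f, hf, hTf, heq⟩ | ⟨hL, heq⟩ := σ.step_cases T a r
  · rw [heq]
    exact InsertionState.slideStep_move h hT ha hb hN hf hTf
  · rw [heq]
    exact InsertionState.slideStep_stay h hT ha hb hN hL

theorem IsAt.step_result_iff (hv : v ≤ r) :
    (σ.step T a r).result b e = some v ↔ σ.result a e = some v := by
  have h' := h.step hT ha hb
  obtain ⟨f, hf, hTf, heq⟩ | ⟨hL, heq⟩ := σ.step_cases T a r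
  · rw [heq] at h' ⊢
    exact InsertionState.placed_eq_some_iff_of_lt h' (Nat.lt_succ_of_le hv)
  · rw [heq, result, InsertionState.placed_stay h hT ha hb hL, result]

end

end PendingInsertion

/-- The insertion of `x` into the first row of `T`, after the labels at most `t` have been passed;
`A r` are the row ends of the labels at most `r`. -/
noncomputable def insertionAt (T : Filling ℕ) (A : ℕ → ℕ → ℕ) (x : ℕ) : ℕ → PendingInsertion
  | 0 => ⟨.row 0, x, T⟩
  | t + 1 => if x ≤ t then (insertionAt T A x t).step T (A t) t else ⟨.row 0, x, T⟩

/-- The growth diagram of the insertion of `x` into the first row of `T`, where `A r` are the row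
ends of the labels at most `r`: the row `1, …, N` after it has been slid past the labels at most `t`
of `T`, moved by `(1, 1)`, and of the letter `x` at the end of the first row. -/
noncomputable def insertionGrowth (T : Filling ℕ) (A : ℕ → ℕ → ℕ) (N x t : ℕ) : ℕ → ℕ → ℕ :=
  if x ≤ t then (insertionAt T A x t).label N (A t) else freshLabel N (A t)

section

variable {T P : Filling ℕ} {A : ℕ → ℕ → ℕ} {N q r t v x i j : ℕ} {e : Box}

theorem insertionAt_succ (hx : x ≤ t) :
    insertionAt T A x (t + 1) = (insertionAt T A x t).step T (A t) t :=
  if_pos hx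

theorem insertionAt_self (T : Filling ℕ) (A : ℕ → ℕ → ℕ) (x : ℕ) :
    insertionAt T A x x = ⟨.row 0, x, T⟩ := by
  cases x with
  | zero => rfl
  | succ x => exact if_neg x.lt_irrefl

section

variable (hT : IsLocallyIncreasing T) (hA : ∀ r, HasEnds T r (A r)) (hx : 0 < x)

include hT hA hx

theorem isAt_insertionAt (ht : x ≤ t) : (insertionAt T A x t).IsAt T (A t) t := by
  induction t, ht using Nat.le_induction with
  | base => exact insertionAt_self T A x ▸ InsertionState.initial hT (hA x) hx
  | succ t ht ih => exact insertionAt_succ (A := A) ht ▸ ih.step hT (hA t) (hA (t + 1))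

theorem insertsTo_of_insertionAt (ht : x ≤ t)
    (hP : InsertsTo (insertionAt T A x t).line (insertionAt T A x t).tableau
      (insertionAt T A x t).letter P) :
    InsertsTo (.row 0) T x P := by
  induction t, ht using Nat.le_induction with
  | base => simpa only [insertionAt_self] using hP
  | succ t ht ih =>
    rw [insertionAt_succ ht] at hP
    exact ih ((isAt_insertionAt hT hA hx ht).insertsTo_of_step hT (hA t) (hA (t + 1)) hP)

theorem insertsTo_result (hq : ∀ e v, T e = some v → v ≤ q) (hxq : x ≤ q) :
    InsertsTo (.row 0) T x ((insertionAt T A x q).result (A q)) := by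
  have h := isAt_insertionAt hT hA hx hxq
  refine insertsTo_of_insertionAt hT hA hx hxq (InsertionState.insertsTo_placed h ?_)
  intro e v hv
  by_contra! hqv
  exact hqv.not_ge (hq e v ((InsertionState.high h hqv).1 hv))

theorem result_iff_of_le (hxr : x ≤ r) (hrt : r ≤ t) (hv : v ≤ r) :
    (insertionAt T A x t).result (A t) e = some v ↔
      (insertionAt T A x r).result (A r) e = some v := by
  induction t, hrt using Nat.le_induction with
  | base => rfl
  | succ t hrt ih =>
    have hxt := hxr.trans hrt
    rw [insertionAt_succ hxt, ← ih]
    exact (isAt_insertionAt hT hA hx hxt).step_result_iff hT (hA t) (hA (t + 1)) (hv.trans hrt)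

theorem result_iff_of_lt (hxt : x ≤ t) (hv : v < x) :
    (insertionAt T A x t).result (A t) e = some v ↔ T e = some v := by
  have h := isAt_insertionAt hT hA hx le_rfl
  rw [result_iff_of_le hT hA hx le_rfl hxt hv.le]
  rw [PendingInsertion.IsAt, insertionAt_self] at h
  rw [insertionAt_self]
  exact h.placed_eq_some_iff_of_lt hv

theorem slideStep_insertionGrowth (hN : A (t + 1) 0 < N) :
    SlideStep (N + 1) (insertionGrowth T A N x t) (insertionGrowth T A N x (t + 1)) := by
  unfold insertionGrowth
  obtain hxt | rfl | hxt : x ≤ t ∨ x = t + 1 ∨ t + 1 < x := by omega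
  · rw [if_pos hxt, if_pos (by omega), insertionAt_succ hxt]
    exact (isAt_insertionAt hT hA hx hxt).slideStep hT (hA t) (hA (t + 1)) hN
  · rw [if_neg (by omega), if_pos le_rfl, insertionAt_self]
    exact slideStep_initial hT (hA t) (hA (t + 1)) hN
  · rw [if_neg (by omega), if_neg (by omega)]
    exact slideStep_fresh (hA t).shape (hA (t + 1)).shape ((hA t).rookStrip hT (hA (t + 1))) hN

theorem insertionGrowth_eq_zero_iff (hxq : x ≤ q) (ht : t ≤ q) :
    insertionGrowth T A N x t i j = 0 ↔
      j < i ∨ ∃ v ≤ t, (insertionAt T A x q).result (A q) (i, j) = some v := by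
  unfold insertionGrowth
  split_ifs with hxt
  · simp only [← exists_congr fun v => and_congr_right fun hv : v ≤ t =>
      (result_iff_of_le hT hA hx hxt ht hv (e := (i, j))).symm]
    exact (isAt_insertionAt hT hA hx hxt).lineLabel_eq_zero_iff
  · have := (hA t).shape.le i
    have hiff : (∃ v ≤ t, (insertionAt T A x q).result (A q) (i, j) = some v) ↔
        i ≤ j ∧ j < A t i := by
      rw [← (hA t).iff]
      exact exists_congr fun v => and_congr_right fun hv =>
        result_iff_of_lt hT hA hx hxq (by omega)
    rw [freshLabel_eq_zero_iff, hiff]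
    omega

theorem insertionGrowth_le_iff (hN : A t 0 < N) :
    insertionGrowth T A N x t i j ≤ N ↔ j < skewEnd (if x ≤ t then N + 1 else N) (A t) i := by
  unfold insertionGrowth
  split_ifs with hxt
  · exact (isAt_insertionAt hT hA hx hxt).lineLabel_le_iff hN
  · exact (hA t).shape.freshLabel_le_iff hN

theorem isLevel_zero_result (hq : ∀ e v, T e = some v → v ≤ q) (hxq : x ≤ q) :
    IsLevel (insertionGrowth T A N x) q 0 ((insertionAt T A x q).result (A q)) := by
  have h := isAt_insertionAt hT hA hx hxq
  have hP : IsLocallyIncreasing ((insertionAt T A x q).result (A q)) := h.isLocallyIncreasing_placed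
  refine .of_le_iff (B := fun i j => j < i) (fun i j hij => (hP.pos hij).false) ?_ ?_ ?_
  · intro i j v hv
    obtain heq | heq := InsertionState.placed_eq_or (A q) (insertionAt T A x q).line
      (insertionAt T A x q).letter (insertionAt T A x q).tableau (i, j)
    · by_contra! hqv
      exact hqv.not_ge (hq _ v ((h.high hqv).1 (heq.symm.trans hv)))
    · exact (Option.some.inj (heq.symm.trans hv)) ▸ h.le
  · intro i j hij
    exact Option.eq_none_iff_forall_ne_some.2 fun v hv => (hP.le hv).not_gt hij
  · intro t ht i j
    rw [Nat.le_zero]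
    exact insertionGrowth_eq_zero_iff hT hA hx hxq ht

end

end

/-! ### Moving a filling by one row and one column -/

/-- The filling `F`, moved one row down and one column to the right, with an additional box labelled
`x` in the first row and column `N`. -/
def embed {α : Type} (N : ℕ) (x : α) (F : Filling α) : Filling α
  | (0, j) => if j = N then some x else none
  | (_ + 1, 0) => none
  | (i + 1, j + 1) => F (i, j)

theorem embed_eq_some_iff {α : Type} {N : ℕ} {x y : α} {F : Filling α} {i j : ℕ} :
    embed N x F (i, j) = some y ↔ i = 0 ∧ j = N ∧ x = y ∨
      ∃ i' j', i = i' + 1 ∧ j = j' + 1 ∧ F (i', j') = some y := by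
  obtain _ | i := i
  · by_cases hj : j = N <;> simp [embed, hj]
  · obtain _ | j := j <;> simp [embed]

section

variable {α : Type} {T : Filling α} {b : Box}

theorem switch_of_none (c d : α) (h : T b = none) : switch c d T b = none := by
  simp [switch, h]

theorem switch_of_isolated (c d : α) (h : ∀ e, Adjacent b e → T e = none) :
    switch c d T b = T b := by
  have hno (x : α) : ¬ ∃ e, Adjacent b e ∧ T e = some x := by
    rintro ⟨e, he, hx⟩
    exact Option.some_ne_none x (hx.symm.trans (h e he))
  simp only [switch, hno, and_false, if_false]

variable {F : Filling α} {M N i j : ℕ}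

theorem exists_adjacent_iff (p : Box → Prop) (i j : ℕ) : (∃ b, Adjacent (i, j) b ∧ p b) ↔
    p (i, j + 1) ∨ p (i + 1, j) ∨ (∃ j', j = j' + 1 ∧ p (i, j')) ∨
      ∃ i', i = i' + 1 ∧ p (i', j) := by
  simp only [adjacent_iff]
  grind

theorem exists_adjacent_embed (x y : α) (h : i ≠ 0 ∨ j + 1 ≠ N) :
    (∃ b, Adjacent (i + 1, j + 1) b ∧ embed N x F b = some y) ↔
      ∃ b, Adjacent (i, j) b ∧ F b = some y := by
  have hleft : (∃ j', j + 1 = j' + 1 ∧ embed N x F (i + 1, j') = some y) ↔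
      ∃ j', j = j' + 1 ∧ F (i, j') = some y := by
    cases j <;> simp [embed]
  have hup : (∃ i', i + 1 = i' + 1 ∧ embed N x F (i', j + 1) = some y) ↔
      ∃ i', i = i' + 1 ∧ F (i', j) = some y := by
    cases i with
    | zero => simp [embed, h.resolve_left (not_not.2 rfl)]
    | succ i => simp [embed]
  rw [exists_adjacent_iff, exists_adjacent_iff, hleft, hup]
  rfl

theorem switch_embed_first_row (c d x : α) (hF : F (0, M) = none) (j : ℕ) :
    switch c d (embed (M + 1) x F) (0, j) = embed (M + 1) x F (0, j) := by
  by_cases hj : j = M + 1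
  · refine switch_of_isolated c d fun e he => ?_
    subst hj
    rcases (adjacent_iff _ _ e).1 he with rfl | rfl | ⟨j', hj', rfl⟩ | ⟨i', hi', -⟩
    · exact if_neg (by omega)
    · exact hF
    · exact if_neg (by omega)
    · omega
  · have hnone : embed (M + 1) x F (0, j) = none := if_neg hj
    rw [switch_of_none c d hnone, hnone]

theorem switch_embed (c d x : α) (hF : F (0, M) = none) :
    switch c d (embed (M + 1) x F) = embed (M + 1) x (switch c d F) := by
  funext ⟨i, j⟩
  obtain _ | i := i
  · exact switch_embed_first_row c d x hF j
  obtain _ | j := j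
  · exact switch_of_none c d rfl
  by_cases h : i = 0 ∧ j = M
  · obtain ⟨rfl, rfl⟩ := h
    have hnone : embed (j + 1) x F (0 + 1, j + 1) = none := hF
    exact (switch_of_none c d hnone).trans (switch_of_none c d hF).symm
  · have hadj (y : α) :=
      exists_adjacent_embed (F := F) (N := M + 1) (i := i) (j := j) x y (by omega)
    classical
    exact if_congr (and_congr_right' (hadj d)) rfl (if_congr (and_congr_right' (hadj c)) rfl rfl)

end

section

variable {C : Set Box} {M : ℕ}

theorem foldl_switch_embed (x : Label) (ks : List ℕ) {F : Filling Label} (hF : F (0, M) = none) :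
    ks.foldl (fun S r => switch (.num r) .circ S) (embed (M + 1) x F) =
        embed (M + 1) x (ks.foldl (fun S r => switch (.num r) .circ S) F) ∧
      ks.foldl (fun S r => switch (.num r) .circ S) F (0, M) = none := by
  induction ks generalizing F with
  | nil => exact ⟨rfl, hF⟩
  | cons k ks ih =>
    rw [List.foldl_cons, List.foldl_cons, switch_embed _ _ _ hF]
    exact ih (switch_of_none _ _ hF)

theorem addCirc_embed (C : Set Box) (N x : ℕ) (F : Filling ℕ) :
    addCirc (Prod.map Nat.succ Nat.succ '' C) (embed N x F) = embed N (.num x) (addCirc C F) := by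
  have hinj : (Prod.map Nat.succ Nat.succ).Injective :=
    Nat.succ_injective.prodMap Nat.succ_injective
  funext ⟨i, j⟩
  unfold addCirc
  obtain _ | i := i
  · by_cases hj : j = N <;> simp [embed, hj]
  obtain _ | j := j
  · simp [embed]
  · have hmem : (i + 1, j + 1) ∈ Prod.map Nat.succ Nat.succ '' C ↔ (i, j) ∈ C :=
      hinj.mem_set_image (a := (i, j))
    classical
    exact if_congr hmem rfl rfl

theorem eraseCirc_embed (N x : ℕ) (F : Filling Label) :
    eraseCirc (embed N (.num x) F) = embed N x (eraseCirc F) := by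
  funext ⟨i, j⟩
  obtain _ | i := i
  · by_cases hj : j = N <;> simp [eraseCirc, embed, hj]
  obtain _ | j := j <;> rfl

theorem kjdt_embed {F : Filling ℕ} (lo hi x : ℕ) (hF : F (0, M) = none) (hC : (0, M) ∉ C) :
    kjdt lo hi (Prod.map Nat.succ Nat.succ '' C) (embed (M + 1) x F) =
        embed (M + 1) x (kjdt lo hi C F) ∧
      kjdt lo hi C F (0, M) = none := by
  have hnone : addCirc C F (0, M) = none := by rw [addCirc, if_neg hC, hF, Option.map_none]
  obtain ⟨hembed, hM⟩ := foldl_switch_embed (.num x) (List.range' lo (hi + 1 - lo)) hnone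
  unfold kjdt
  constructor
  · rw [addCirc_embed, hembed, eraseCirc_embed]
  · rw [eraseCirc, hM]

theorem foldl_kjdt_embed {C C' : ℕ → Set Box} (lo hi x d : ℕ) (ks : List ℕ) {F : Filling ℕ}
    (hF : F (0, M) = none) (hC : ∀ k ∈ ks, (0, M) ∉ C k)
    (hC' : ∀ k ∈ ks, C' (d + k) = Prod.map Nat.succ Nat.succ '' C k) :
    (ks.map (d + ·)).foldl (fun S k => kjdt lo hi (C' k) S) (embed (M + 1) x F) =
      embed (M + 1) x (ks.foldl (fun S k => kjdt lo hi (C k) S) F) := by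
  induction ks generalizing F with
  | nil => rfl
  | cons k ks ih =>
    rw [List.forall_mem_cons] at hC hC'
    obtain ⟨hembed, hM⟩ := kjdt_embed lo hi x hF hC.1
    rw [List.map_cons, List.foldl_cons, List.foldl_cons, hC'.1, hembed]
    exact ih hM hC.2 hC'.2

end

/-! ### Sliding into the first row is insertion -/

section

variable {T : Filling ℕ} {a : ℕ → ℕ} {M N i j : ℕ}

theorem HasEnds.zero_eq (ha : HasEnds T 0 a) (hT : IsLocallyIncreasing T) (i : ℕ) : a i = i := by
  refine (ha.shape.le i).antisymm' (not_lt.1 fun hi => ?_)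
  obtain ⟨v, hv, h⟩ := (ha.iff i i).2 ⟨le_rfl, hi⟩
  exact (hT.pos h).ne' (Nat.le_zero.1 hv)

theorem HasEnds.first_le (ha : HasEnds T M a) (hM : ∀ j v, T (0, j) = some v → j < N) :
    a 0 ≤ N := by
  by_contra! h
  obtain ⟨v, -, hv⟩ := (ha.iff 0 N).2 ⟨N.zero_le, h⟩
  exact (hM N v hv).false

theorem freshLabel_diag (ha : ∀ i, a i = i) (N i j : ℕ) :
    j < i ∧ freshLabel N a i j = 0 ∨ i = 0 ∧ j < N ∧ freshLabel N a i j = j + 1 ∨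
      i ≤ j ∧ (i = 0 → N ≤ j) ∧ freshLabel N a i j = N + 1 := by
  have := growthRow_cases (N + 1) (a i) (skewEnd N a i) (i + 1) 1 j
  have := ha i
  have : i = 0 ∧ skewEnd N a i = N ∨ 0 < i ∧ skewEnd N a i = i := by
    cases i with
    | zero => exact .inl ⟨rfl, rfl⟩
    | succ i => exact .inr ⟨i.succ_pos, congrArg (· + 1) (ha i)⟩
  unfold freshLabel
  omega

theorem isIncreasingArray_freshLabel_diag (ha : ∀ i, a i = i) (N : ℕ) :
    IsIncreasingArray (N + 1) (freshLabel N a) where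
  le i j := by
    have := freshLabel_diag ha N i j
    omega
  row i j := by
    have := freshLabel_diag ha N i j
    have := freshLabel_diag ha N i (j + 1)
    unfold StrictBelow
    omega
  col i j h := by
    have := freshLabel_diag ha N i j
    have := freshLabel_diag ha N (i + 1) j
    unfold StrictBelow
    omega
  below i j h := by
    have := freshLabel_diag ha N i j
    omega

end

section

variable {T : Filling ℕ} {A : ℕ → ℕ → ℕ} {M N q x : ℕ}

theorem isLevel_embed (hT : IsLocallyIncreasing T) (hA : ∀ r, HasEnds T r (A r))
    (hq : ∀ e v, T e = some v → v ≤ q) (hN : ∀ t, A t 0 < N) (hx : 0 < x) (hxq : x ≤ q) :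
    IsLevel (insertionGrowth T A N x) q N (embed N x T) := by
  refine .of_le_iff (B := fun i j => j < i ∨ i = 0 ∧ j < N) (fun i j => ?_) (fun i j v => ?_)
    (fun i j hij => ?_) fun t _ i j => ?_
  · rw [Ne, embed_eq_some_iff]
    rintro (⟨-, -, h⟩ | ⟨_, _, -, -, h⟩)
    · exact hx.ne' h
    · exact (hT.pos h).false
  · rw [embed_eq_some_iff]
    rintro (⟨-, -, rfl⟩ | ⟨_, _, -, -, h⟩)
    · exact hxq
    · exact hq _ v h
  · refine Option.eq_none_iff_forall_ne_some.2 fun v => ?_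
    rw [Ne, embed_eq_some_iff]
    rintro (⟨rfl, rfl, -⟩ | ⟨i, j, rfl, rfl, h⟩)
    · omega
    · have := hT.le h
      omega
  rw [insertionGrowth_le_iff hT hA hx (hN t)]
  obtain _ | i := i
  · simp only [embed_eq_some_iff, skewEnd]
    split_ifs <;> simp <;> omega
  obtain _ | j := j
  · simp [skewEnd, embed]
  · have hiff : (∃ v ≤ t, embed N x T (i + 1, j + 1) = some v) ↔ i ≤ j ∧ j < A t i :=
      (hA t).iff i j
    have := (hA t).shape.le i
    rw [hiff, skewEnd]
    omega

theorem insertsTo_foldl_kjdt {C : ℕ → Set Box} (hT : IsLocallyIncreasing T)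
    (hq : ∀ e v, T e = some v → v ≤ q) (hM : ∀ j v, T (0, j) = some v → j < M) (hN : M < N)
    (hx : 0 < x) (hxq : x ≤ q) (hC : ∀ m < N, C (m + 1) = {(0, m)}) :
    InsertsTo (.row 0) T x
      ((List.range' 1 N).reverse.foldl (fun S k => kjdt 1 q (C k) S) (embed N x T)) := by
  choose A hA using hT.exists_hasEnds
  have hN (t : ℕ) : A t 0 < N := ((hA t).first_le hM).trans_lt hN
  have hstep (t : ℕ) := slideStep_insertionGrowth hT hA hx (hN (t + 1))
  have hdiag := (hA 0).zero_eq hT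
  have hzero : insertionGrowth T A N x 0 = freshLabel N (A 0) := if_neg hx.not_ge
  have hI (t : ℕ) : IsIncreasingArray (N + 1) (insertionGrowth T A N x t) := by
    induction t with
    | zero => exact hzero ▸ isIncreasingArray_freshLabel_diag hdiag N
    | succ t ih => exact (hstep t).isIncreasingArray ih
  have hCm (m : ℕ) (hm : m < N) (b : Box) :
      b ∈ C (m + 1) ↔ insertionGrowth T A N x 0 b.1 b.2 = m + 1 := by
    have := freshLabel_diag hdiag N b.1 b.2
    rw [hC m hm, hzero, Set.mem_singleton_iff, Prod.ext_iff]
    omega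
  have hlevel := (isLevel_embed hT hA hq hN hx hxq).foldl_kjdt le_rfl hCm
    (fun t _ => hstep t) fun t _ => hI t
  exact hlevel.unique (isLevel_zero_result hT hA hx hq hxq) ▸ insertsTo_result hT hA hx hq hxq

end

/-! ### Uniqueness of the insertion tableau -/

section

variable {T P Q : Filling ℕ} {L : Line} {b c : Box} {q v x y z : ℕ}

theorem Line.IsEnd.unique (hb : L.IsEnd T b) (hc : L.IsEnd T c) : b = c := by
  obtain ⟨bi, bj⟩ := b
  obtain ⟨ci, cj⟩ := c
  cases L with
  | row i =>
    obtain ⟨rfl, hb, hbT, hbmin⟩ := hb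
    obtain ⟨rfl, hc, hcT, hcmin⟩ := hc
    have hle : bj ≤ cj := not_lt.1 fun h => hbmin cj hc h hcT
    have hge : cj ≤ bj := not_lt.1 fun h => hcmin bj hb h hbT
    rw [hle.antisymm hge]
  | col j =>
    obtain ⟨rfl, hbT, hbmin⟩ := hb
    obtain ⟨rfl, hcT, hcmin⟩ := hc
    have hle : bi ≤ ci := not_lt.1 fun h => hbmin ci h hcT
    have hge : ci ≤ bi := not_lt.1 fun h => hcmin bi h hbT
    rw [hle.antisymm hge]

theorem IsIncreasing.eq_of_contains (hT : IsIncreasing T) (hb : L.Contains b) (hc : L.Contains c)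
    (hbv : T b = some v) (hcv : T c = some v) : b = c := by
  obtain ⟨bi, bj⟩ := b
  obtain ⟨ci, cj⟩ := c
  cases L with
  | row i =>
    obtain rfl : bi = i := hb
    obtain rfl : ci = bi := hc
    have hle : bj ≤ cj := not_lt.1 fun h => (hT.1 _ _ _ _ _ h hcv hbv).false
    have hge : cj ≤ bj := not_lt.1 fun h => (hT.1 _ _ _ _ _ h hbv hcv).false
    rw [hle.antisymm hge]
  | col j =>
    obtain rfl : bj = j := hb
    obtain rfl : cj = bj := hc
    have hle : bi ≤ ci := not_lt.1 fun h => (hT.2 _ _ _ _ _ h hcv hbv).false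
    have hge : ci ≤ bi := not_lt.1 fun h => (hT.2 _ _ _ _ _ h hbv hcv).false
    rw [hle.antisymm hge]

theorem Line.IsBumped.unique (hT : IsIncreasing T) (hb : L.IsBumped T x b y)
    (hc : L.IsBumped T x c z) : b = c ∧ y = z := by
  obtain ⟨hb, hby, hxy, hymin⟩ := hb
  obtain ⟨hc, hcz, hxz, hzmin⟩ := hc
  obtain rfl : y = z := (hymin c z hc hcz hxz).antisymm (hzmin b y hb hby hxy)
  exact ⟨hT.eq_of_contains hb hc hby hcz, rfl⟩

theorem Line.AllLE.not_isBumped (h : L.AllLE T x) : ¬ L.IsBumped T x b y :=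
  fun ⟨hb, hy, hxy, _⟩ => (h b y hb hy).not_gt hxy

theorem IsIncreasingTableau.isIncreasing (hT : IsIncreasingTableau T) : IsIncreasing T :=
  let ⟨_, _, _, _, h⟩ := hT
  h

theorem InsertsTo.unique (hP : InsertsTo L T x P) (hT : IsIncreasing T) (hQ : InsertsTo L T x Q) :
    P = Q := by
  induction hP with
  | adjoin hx hb h =>
    cases hQ with
    | adjoin _ hb' _ => rw [hb.unique hb']
    | stay _ hb' h' => exact absurd (hb.unique hb' ▸ h) h'
    | replace hb' => exact absurd hb' hx.not_isBumped
    | bump hb' => exact absurd hb' hx.not_isBumped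
  | stay hx hb h =>
    cases hQ with
    | adjoin _ hb' h' => exact absurd h' (hb.unique hb' ▸ h)
    | stay => rfl
    | replace hb' => exact absurd hb' hx.not_isBumped
    | bump hb' => exact absurd hb' hx.not_isBumped
  | replace hb h rest ih =>
    cases hQ with
    | adjoin hx => exact absurd hb hx.not_isBumped
    | stay hx => exact absurd hb hx.not_isBumped
    | replace hb' _ rest' =>
      obtain ⟨rfl, rfl⟩ := hb.unique hT hb'
      exact ih h.isIncreasing rest'
    | bump hb' h' _ =>
      obtain ⟨rfl, -⟩ := hb.unique hT hb'
      exact absurd h h'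
  | bump hb h rest ih =>
    cases hQ with
    | adjoin hx => exact absurd hb hx.not_isBumped
    | stay hx => exact absurd hb hx.not_isBumped
    | replace hb' h' _ =>
      obtain ⟨rfl, -⟩ := hb.unique hT hb'
      exact absurd h' h
    | bump hb' _ rest' =>
      obtain ⟨rfl, rfl⟩ := hb.unique hT hb'
      exact ih hT rest'

theorem InsertsTo.isIncreasingTableau (h : InsertsTo L T x P) (hT : IsIncreasingTableau T) :
    IsIncreasingTableau P := by
  induction h with
  | adjoin _ _ h => exact h
  | stay => exact hT
  | replace _ h _ ih => exact ih h
  | bump _ _ _ ih => exact ih hT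

theorem InsertsTo.entry_le (h : InsertsTo L T x P) (hx : x ≤ q) (hT : ∀ e v, T e = some v → v ≤ q) :
    ∀ e v, P e = some v → v ≤ q := by
  have hset {T : Filling ℕ} {b : Box} {x : ℕ} (hx : x ≤ q) (hT : ∀ e v, T e = some v → v ≤ q) :
      ∀ e v, T.set b x e = some v → v ≤ q := by
    intro e v he
    rcases Filling.set_eq_some.1 he with ⟨-, rfl⟩ | ⟨-, he⟩
    · exact hx
    · exact hT e v he
  induction h with
  | adjoin => exact hset hx hT
  | stay => exact hT
  | replace hb _ _ ih => exact ih (hT _ _ hb.2.1) (hset hx hT)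
  | bump hb _ _ ih => exact ih (hT _ _ hb.2.1) hT

theorem InsertsTo.column_lt_succ {M : ℕ} (h : InsertsTo L T x P)
    (hT : ∀ j v, T (0, j) = some v → j < M) : ∀ j v, P (0, j) = some v → j < M + 1 := by
  induction h with
  | @adjoin _ T x b _ _ h =>
    intro j v hj
    by_contra! hMj
    obtain ⟨u, -, hu⟩ := h.isLocallyIncreasing.left_lt hj M.zero_le hMj
    have hM : (0, M) = b := by
      rcases Filling.set_eq_some.1 hu with ⟨hb, -⟩ | ⟨-, hu⟩
      · exact hb
      · exact absurd (hT M u hu) M.lt_irrefl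
    rcases Filling.set_eq_some.1 hj with ⟨hb, -⟩ | ⟨-, hj⟩
    · have := congrArg Prod.snd (hb.trans hM.symm)
      simp only at this
      omega
    · have := hT j v hj
      omega
  | stay => exact fun j v hj => (hT j v hj).trans M.lt_add_one
  | @replace _ T _ x y b hb _ _ ih =>
    refine ih fun j v hj => ?_
    rcases Filling.set_eq_some.1 hj with ⟨rfl, -⟩ | ⟨-, hj⟩
    · exact hT j y hb.2.1
    · exact hT j v hj
  | bump _ _ _ ih => exact ih hT

end

theorem isLocallyIncreasing_empty : IsLocallyIncreasing fun _ => none where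
  le h := nomatch h
  pos h := nomatch h
  left h := nomatch h
  up h := nomatch h
  bounded := ⟨0, fun _ _ _ h => nomatch h⟩

section

variable {w : List ℕ} {P Q : Filling ℕ} {q : ℕ}

theorem IsInsertionTableau.isIncreasingTableau (h : IsInsertionTableau w P) :
    IsIncreasingTableau P := by
  induction h with
  | nil => exact isLocallyIncreasing_empty.isIncreasingTableau
  | snoc _ hx ih => exact hx.isIncreasingTableau ih

theorem IsInsertionTableau.unique (hP : IsInsertionTableau w P) (hQ : IsInsertionTableau w Q) :
    P = Q := by
  induction hP generalizing Q with
  | nil =>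
    generalize hw : ([] : List ℕ) = w at hQ
    cases hQ with
    | nil => rfl
    | snoc => exact absurd hw (List.append_ne_nil_of_right_ne_nil _ (List.cons_ne_nil _ _)).symm
  | snoc hT hx ih =>
    generalize hw : _ ++ [_] = w at hQ
    cases hQ with
    | nil => exact absurd hw (List.append_ne_nil_of_right_ne_nil _ (List.cons_ne_nil _ _))
    | snoc hT' hx' =>
      obtain ⟨rfl, hxx⟩ := List.append_inj' hw rfl
      obtain rfl := List.singleton_inj.1 hxx
      obtain rfl := ih hT'
      exact hx.unique hT.isIncreasingTableau.isIncreasing hx'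

theorem IsInsertionTableau.entry_le (h : IsInsertionTableau w P) (hw : ∀ x ∈ w, x ≤ q) :
    ∀ e v, P e = some v → v ≤ q := by
  induction h with
  | nil => exact fun _ _ h => nomatch h
  | snoc _ hx ih =>
    rw [List.forall_mem_append, List.forall_mem_singleton] at hw
    exact hx.entry_le hw.2 (ih hw.1)

theorem IsInsertionTableau.column_lt_length (h : IsInsertionTableau w P) :
    ∀ j v, P (0, j) = some v → j < w.length := by
  induction h with
  | nil => exact fun _ _ h => nomatch h
  | snoc _ hx ih =>
    rw [List.length_append, List.length_singleton]
    exact hx.column_lt_succ ih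

end

/-! ### The antidiagonal tableau -/

theorem antidiagonalInner_succ {n : ℕ} (hn : 0 < n) :
    antidiagonalInner (n + 1) = 2 * n :: antidiagonalInner n := by
  obtain ⟨n, rfl⟩ := Nat.exists_eq_add_one.2 hn
  unfold antidiagonalInner
  simp only [Nat.add_sub_cancel, List.range_succ_eq_map (n := n), List.map_cons, List.map_map]
  congr 1
  refine List.map_congr_left fun i _ => ?_
  simp only [Function.comp]
  omega

theorem antidiagonalFilling_append (w : List ℕ) (x : ℕ) :
    antidiagonalFilling (w ++ [x]) = embed (2 * w.length) x (antidiagonalFilling w) := by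
  funext ⟨i, j⟩
  unfold antidiagonalFilling
  simp only [List.length_append, List.length_singleton, List.reverse_append, List.reverse_singleton,
    List.singleton_append]
  obtain _ | i := i
  · exact if_congr (by omega) rfl rfl
  obtain _ | j := j
  · rw [List.getElem?_cons_succ, embed, ite_eq_right_iff]
    intro h
    rw [List.getElem?_eq_none]
    rw [List.length_reverse]
    omega
  · exact if_congr (by omega) rfl rfl

theorem superstandard_cons_zero (m : ℕ) (l : List ℕ) {k : ℕ} (hk : k < m) :
    {b | superstandard (m :: l) b = some (k + 1)} = {(0, k)} := by
  ext ⟨i, j⟩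
  simp only [superstandard, Set.mem_ofPred_eq, Set.mem_singleton_iff, Prod.mk.injEq,
    Option.ite_none_right_eq_some, Option.some.injEq]
  obtain _ | i := i
  · simp only [List.getD_cons_zero, List.take_zero, List.sum_nil, true_and]
    omega
  · simp only [List.take_succ_cons, List.sum_cons]
    omega

theorem superstandard_cons_add (m : ℕ) (l : List ℕ) {k : ℕ} (hk : 0 < k) :
    {b | superstandard (m :: l) b = some (m + k)} =
      Prod.map Nat.succ Nat.succ '' {b | superstandard l b = some k} := by
  ext ⟨i, j⟩
  simp only [superstandard, Set.mem_ofPred_eq, Set.mem_image, Prod.exists, Prod.map_apply,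
    Prod.mk.injEq, Nat.succ_eq_add_one, Option.ite_none_right_eq_some, Option.some.injEq]
  obtain _ | i := i
  · simp only [List.getD_cons_zero, List.take_zero, List.sum_nil]
    refine iff_of_false (by omega) ?_
    rintro ⟨_, _, -, h, -⟩
    omega
  · simp only [List.getD_cons_succ, List.take_succ_cons, List.sum_cons]
    constructor
    · intro h
      exact ⟨i, j - 1, by omega⟩
    · rintro ⟨i', j', h, hi, rfl⟩
      obtain rfl : i' = i := Nat.succ_injective hi
      omega

theorem foldl_range'_add {β : Type*} (f : β → ℕ → β) (m n : ℕ) (z : β) :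
    (List.range' 1 (m + n)).reverse.foldl f z =
      (List.range' 1 m).reverse.foldl f (((List.range' 1 n).reverse.map (m + ·)).foldl f z) := by
  rw [← List.range'_append_1, List.reverse_append, List.foldl_append, List.map_reverse,
    List.map_add_range', add_comm 1 m]

theorem insertsTo_empty {x : ℕ} (hx : 0 < x) :
    InsertsTo (.row 0) (fun _ => none) x (embed 0 x fun _ => none) := by
  have hset : embed 0 x (fun _ => none) = Filling.set (fun _ => none) (0, 0) x := by
    funext ⟨i, j⟩
    rw [Filling.set_apply]
    obtain _ | i := i
    · simp [embed]
    obtain _ | j := j <;> simp [embed]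
  rw [hset]
  refine .adjoin (fun _ _ _ h => nomatch h) ⟨rfl, le_rfl, rfl, fun j _ hj => by simp at hj⟩ ?_
  rw [isIncreasingTableau_iff, isLocallyIncreasing_empty.set_iff le_rfl hx fun v h => nomatch h]
  exact ⟨fun j _ => by omega, fun h => by omega⟩

theorem antidiagonalFilling_nil : antidiagonalFilling [] = fun _ => none := by
  funext b
  simp [antidiagonalFilling]

theorem isInsertionTableau_foldl_kjdt {q : ℕ} (w : List ℕ) (hw : ∀ x ∈ w, 0 < x ∧ x ≤ q) :
    IsInsertionTableau w ((List.range' 1 (antidiagonalInner w.length).sum).reverse.foldl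
      (fun S k => kjdt 1 q {b | superstandard (antidiagonalInner w.length) b = some k} S)
      (antidiagonalFilling w)) := by
  induction w using List.reverseRecOn with
  | nil => exact antidiagonalFilling_nil ▸ .nil
  | append_singleton w x ih =>
    rw [List.forall_mem_append, List.forall_mem_singleton] at hw
    obtain ⟨hw, hx, hxq⟩ := hw
    have hP := ih hw
    refine .snoc hP ?_
    rw [antidiagonalFilling_append, List.length_append, List.length_singleton]
    obtain rfl | hw_ne := eq_or_ne w []
    · exact antidiagonalFilling_nil ▸ insertsTo_empty hx
    have hn : 0 < w.length := List.length_pos_iff.2 hw_ne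
    rw [antidiagonalInner_succ hn, List.sum_cons, foldl_range'_add]
    obtain ⟨M, hM⟩ : ∃ M, 2 * w.length = M + 1 := Nat.exists_eq_add_one.2 (by omega)
    have hnone : antidiagonalFilling w (0, M) = none := if_neg (by simp only; omega)
    have hnotMem (k : ℕ) :
        (0, M) ∉ {b | superstandard (antidiagonalInner w.length) b = some k} := by
      simp only [Set.mem_ofPred_eq, superstandard, antidiagonalInner_getD,
        Option.ite_none_right_eq_some]
      omega
    rw [hM, foldl_kjdt_embed 1 q x (M + 1) _ hnone (fun k _ => hnotMem k) fun k hk =>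
      superstandard_cons_add _ _ (List.left_le_of_mem_range' (List.mem_reverse.1 hk))]
    exact insertsTo_foldl_kjdt hP.isIncreasingTableau.isLocallyIncreasing
      (hP.entry_le fun y hy => (hw y hy).2) hP.column_lt_length (by omega) hx hxq
      fun m hm => superstandard_cons_zero _ _ hm

theorem le_maxEntry_antidiagonalTableau {w : List ℕ} (hw : ∀ x ∈ w, 0 < x) {x : ℕ} (hx : x ∈ w) :
    x ≤ (antidiagonalTableau w hw).maxEntry := by
  refine le_csSup ⟨w.sum, ?_⟩ ?_
  · rintro y ⟨b, hb⟩
    change antidiagonalFilling w b = some y at hb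
    rw [antidiagonalFilling, Option.ite_none_right_eq_some] at hb
    exact List.single_le_sum (fun _ _ => zero_le) y
      (List.mem_reverse.1 (List.mem_of_getElem? hb.2))
  · obtain ⟨i, hi, rfl⟩ := List.getElem_of_mem (List.mem_reverse.2 hx)
    have hiw : i < w.length := by rwa [List.length_reverse] at hi
    exact ⟨(i, 2 * w.length - 2 - i),
      (if_pos (by simp only; omega)).trans (List.getElem?_eq_getElem hi)⟩

end ShiftedHecke

/-- For every word `w` of positive integers, shifted Hecke insertion of `w` has exactly one result
`P(w)`, and it is the superstandard K-rectification of the antidiagonal tableau `T_w`. -/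
theorem mainTheorem5 (w : List ℕ) (hw : ∀ x ∈ w, 0 < x) (P : ShiftedHecke.Filling ℕ) :
    ShiftedHecke.IsInsertionTableau w P ↔
      P = (ShiftedHecke.antidiagonalTableau w hw).superstandardRectification := by
  have hrect : ShiftedHecke.IsInsertionTableau w
      (ShiftedHecke.antidiagonalTableau w hw).superstandardRectification :=
    ShiftedHecke.isInsertionTableau_foldl_kjdt w fun x hx =>
      ⟨hw x hx, ShiftedHecke.le_maxEntry_antidiagonalTableau hw hx⟩
  exact ⟨fun hP => hP.unique hrect, fun hP => hP ▸ hrect⟩
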